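/- Write $\mathbb T=\mathbb R/\mathbb Z$ and $\mathbb N=\{1,2,\dots\}$; an integer polynomial is a polynomial in $\mathbb Z[n]$. For $d\in\mathbb N$, a quasi-standard Weyl system of level $d$ is $(\mathbb T^d,T)$ with $$T(x_1,\dots,x_d)=\Big(x_1+\alpha_1,\ x_2+m_{2,1}x_1+\alpha_2,\ \dots,\ x_d+\sum_{j=1}^{d-1}m_{d,j}x_j+\alpha_d\Big),$$ where $\alpha_i\in\mathbb T$, $\alpha_1$ is irrational, $m_{i,j}\in\mathbb Z$, and $m_{i,i-1}\neq0$ for $2\le i\le d$. Integer polynomials $p_1,\dots,p_k$ are essentially distinct if all $p_i$ and all $p_i-p_j$ ($i\ne j$) are nonconstant; put $\tilde p_i=p_i-p_i(0)$. The Weyl complexity $W(p_1,\dots,p_k)$ of such a family is the least $r\in\mathbb N$ such that for every $d\ge r$ and every quasi-standard Weyl system $(X,T)$ of level $d$ $$\{(0,\dots,0,x_r,\dots,x_d): x_r,\dots,x_d\in\mathbb T\}^{k+1}\subset\overline{\{(x,T^{\tilde p_1(n)}x,\dots,T^{\tilde p_k(n)}x): x\in X,\ n\in\mathbb N\}}.$$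 Proposition. Let $p_1,p_2,p_3$ be essentially distinct integer polynomials. Then: (i) $W(p_1,p_2,p_3)=1$ if and only if $\tilde p_1,\tilde p_2,\tilde p_3$ are linearly independent. (ii) $W(p_1,p_2,p_3)=3$ if and only if some permutation of $\tilde p_1,\tilde p_2,\tilde p_3$ has the form $$(lp,\ mp,\ kp^2+rp)\quad\text{or}\quad(kp^2+lp,\ kp^2+mp,\ kp^2+rp)$$ for some integer polynomial $p$ and some $k,l,m,r\in\mathbb Z$. (iii) In all other cases $W(p_1,p_2,p_3)=2$. -/

import Mathlib

open Polynomial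

namespace WeylComplexity

/-- The unipotent affine map
`(x₁, …, x_d) ↦ (x₁ + α₁, x₂ + m₂₁ x₁ + α₂, …, x_d + ∑_{j < d} m_{d j} x_j + α_d)`
of the torus `𝕋 ^ d`. Coordinates are numbered from `0`; only the entries of `M` strictly below
the diagonal are used. -/
noncomputable def weylMap {d : ℕ} (α : Fin d → ℝ) (M : Matrix (Fin d) (Fin d) ℤ)
    (x : Fin d → UnitAddCircle) : Fin d → UnitAddCircle :=
  fun i => x i + ∑ j ∈ Finset.Iio i, M i j • x j + (α i : UnitAddCircle)

theorem weylMap_bijective {d : ℕ} (α : Fin d → ℝ) (M : Matrix (Fin d) (Fin d) ℤ) :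
    Function.Bijective (weylMap α M) := by
  constructor
  · intro x y h
    funext i
    induction i using WellFoundedLT.induction with
    | ind i ih =>
      have hi := congrFun h i
      have hs : ∑ j ∈ Finset.Iio i, M i j • x j = ∑ j ∈ Finset.Iio i, M i j • y j :=
        Finset.sum_congr rfl fun j hj => by rw [ih j (Finset.mem_Iio.mp hj)]
      simp only [weylMap, hs] at hi
      exact add_right_cancel (add_right_cancel hi)
  · intro y
    let F : (i : Fin d) → ((j : Fin d) → j < i → UnitAddCircle) → UnitAddCircle :=
      fun i f => y i - (α i : UnitAddCircle)
        - ∑ j ∈ (Finset.Iio i).attach, M i j.1 • f j.1 (Finset.mem_Iio.mp j.2)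
    let hwf : WellFounded (fun a b : Fin d => a < b) := wellFounded_lt
    refine ⟨fun i => hwf.fix F i, ?_⟩
    funext i
    have h1 : hwf.fix F i = y i - (α i : UnitAddCircle)
        - ∑ j ∈ Finset.Iio i, M i j • hwf.fix F j := by
      rw [hwf.fix_eq F i]
      simp only [F]
      rw [Finset.sum_attach (Finset.Iio i) (fun j => M i j • hwf.fix F j)]
    simp only [weylMap]
    nth_rewrite 1 [h1]
    abel

/-- `weylMap` as an invertible transformation of the torus, so that it has integer powers. -/
noncomputable def weylEquiv {d : ℕ} (α : Fin d → ℝ) (M : Matrix (Fin d) (Fin d) ℤ) :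
    Equiv.Perm (Fin d → UnitAddCircle) :=
  Equiv.ofBijective (weylMap α M) (weylMap_bijective α M)

/-- The data `(α, M)` define a quasi-standard Weyl system of level `d`: the first rotation number
is irrational and all entries `m_{i, i-1}` are nonzero. -/
def IsQuasiStandard {d : ℕ} (α : Fin d → ℝ) (M : Matrix (Fin d) (Fin d) ℤ) : Prop :=
  (∀ i : Fin d, i.val = 0 → Irrational (α i)) ∧
    ∀ i j : Fin d, j.val + 1 = i.val → M i j ≠ 0

/-- The orbit of the diagonal of `X ^ (k + 1)` under the polynomial family `p`:
all points `(x, T ^ p₁(n) x, …, T ^ p_k(n) x)` with `x ∈ X` and `n` a positive integer. -/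
def orbit {X : Type*} {k : ℕ} (p : Fin k → ℤ[X]) (T : Equiv.Perm X) : Set (Fin (k + 1) → X) :=
  {y | ∃ x : X, ∃ n : ℕ, 0 < n ∧
    y = Fin.cons x (fun i : Fin k => (T ^ ((p i).eval (n : ℤ))) x)}

/-- The set `{(0, …, 0, x_r, …, x_d)} ⊆ 𝕋 ^ d` of points whose first `r - 1` coordinates vanish. -/
def tailSet (d r : ℕ) : Set (Fin d → UnitAddCircle) :=
  {x | ∀ i : Fin d, i.val + 1 < r → x i = 0}

/-- For every `d ≥ r` and every quasi-standard Weyl system of level `d`, the set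
`{(0, …, 0, x_r, …, x_d)} ^ (k + 1)` is contained in the closure of the orbit of `p`. -/
def WeylProperty {k : ℕ} (p : Fin k → ℤ[X]) (r : ℕ) : Prop :=
  ∀ d : ℕ, r ≤ d → ∀ (α : Fin d → ℝ) (M : Matrix (Fin d) (Fin d) ℤ), IsQuasiStandard α M →
    {y : Fin (k + 1) → Fin d → UnitAddCircle | ∀ i, y i ∈ tailSet d r} ⊆
      closure (orbit p (weylEquiv α M))

/-- The polynomial `p - p(0)`. -/
noncomputable def tilde (p : ℤ[X]) : ℤ[X] := p - C (p.eval 0)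

/-- The Weyl complexity of a family of integer polynomials: the least positive integer `r` such
that the family `p_i - p_i(0)` satisfies `WeylProperty r` (and the value `0`, which is not a
complexity, if there were no such `r`). -/
noncomputable def weylComplexity {k : ℕ} (p : Fin k → ℤ[X]) : ℕ :=
  sInf {r : ℕ | 1 ≤ r ∧ WeylProperty (fun i => tilde (p i)) r}

/-- All `p_i` and all differences `p_i - p_j` with `i ≠ j` are nonconstant. -/
def EssentiallyDistinct {k : ℕ} (p : Fin k → ℤ[X]) : Prop :=
  (∀ i, ∀ c : ℤ, p i ≠ C c) ∧ ∀ i j, i ≠ j → ∀ c : ℤ, p i - p j ≠ C c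

/-- The triple has the form `(l q, m q, k q² + r q)`. -/
def FormA (f : Fin 3 → ℤ[X]) : Prop :=
  ∃ (q : ℤ[X]) (k l m r : ℤ),
    f 0 = C l * q ∧ f 1 = C m * q ∧ f 2 = C k * q ^ 2 + C r * q

/-- The triple has the form `(k q² + l q, k q² + m q, k q² + r q)`. -/
def FormB (f : Fin 3 → ℤ[X]) : Prop :=
  ∃ (q : ℤ[X]) (k l m r : ℤ),
    f 0 = C k * q ^ 2 + C l * q ∧ f 1 = C k * q ^ 2 + C m * q ∧ f 2 = C k * q ^ 2 + C r * q

/-- Some permutation of the triple has one of the two forms above. -/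
def HasSpecialForm (f : Fin 3 → ℤ[X]) : Prop :=
  ∃ σ : Equiv.Perm (Fin 3), FormA (fun i => f (σ i)) ∨ FormB (fun i => f (σ i))

end WeylComplexity

/-!
The closure of the orbit is determined by the characters of the torus that annihilate it. By Weyl's
equidistribution theorem (`tendsto_cesaro_expChar_eval`, proved by van der Corput differencing) a
polynomial orbit on a torus that starts at `0` has in its closure each point killed by all
characters along which the orbit has rational coefficients (`exists_norm_eval_sub_lt`). To treat all
starting points at once, this is applied along `x_l(n) = β n ^ (D (l + 1))` with `β` irrational and
`D` large: these monomials are so far apart that a character is rational along the resulting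
sequence only if it annihilates the whole orbit identically in `x` and `n` (`charRow_eq_zero`).
Irrationality of `α₁` and the nonvanishing of the `m_{i, i-1}` enter here. Hence the inclusion with
index `r` holds once no annihilating character involves a coordinate of index at least `r`
(`weylProperty_of_charRow`). Conversely an annihilating character of one system which involves such
a coordinate refutes the inclusion (`not_weylProperty_of_character`).

Let `e` be the last coordinate involved in an annihilating character and `f_i = p_i - p_i(0)`. The
coefficients `c_i` at `e` satisfy `∑ c_i f_i = 0`. If `e ≥ 2`, the next coordinate gives
`∑ (w_i f_i + c_i f_i ^ 2) = 0` up to normalization (`QuadraticRelation`), and if `e ≥ 3` there is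
also a relation involving the cubes (`CubicRelation`). So linear independence gives the
inclusion for `r = 1`, and for `r = 2` it suffices that there is no nontrivial quadratic relation.
A nontrivial quadratic relation exists exactly for the two special forms
(`hasSpecialForm_of_quadraticRelation`, `exists_quadraticRelation_of_hasSpecialForm`), where
comparison of degrees and primitivity provide the polynomial `p` with integer coefficients. For the
special forms a quadratic and a cubic relation together force `c = 0`
(`eq_zero_of_cubicRelation`), whence the inclusion for `r = 3`. Linear and quadratic relations
produce annihilating characters of the rotation by `√2` and of the system
`(x₁, x₂) ↦ (x₁ + √2, x₂ + 2 x₁ + √2)`, which gives the lower bounds.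
-/

namespace WeylComplexity

/-! ### Weyl's equidistribution theorem for polynomials -/

/-- The additive character `t ↦ exp (2πit)` of the real line. -/
noncomputable def expChar (t : ℝ) : ℂ := Complex.exp (2 * Real.pi * t * Complex.I)

theorem expChar_add (s t : ℝ) : expChar (s + t) = expChar s * expChar t := by
  rw [expChar, expChar, expChar, ← Complex.exp_add]; push_cast; ring_nf

@[simp] theorem expChar_zero : expChar 0 = 1 := by simp [expChar]

theorem expChar_intCast (z : ℤ) : expChar z = 1 := by
  rw [expChar, Complex.exp_eq_one_iff]
  exact ⟨z, by push_cast; ring⟩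

theorem norm_expChar (t : ℝ) : ‖expChar t‖ = 1 := by
  rw [expChar, show (2 * Real.pi * t * Complex.I : ℂ) = ((2 * Real.pi * t : ℝ) : ℂ) * Complex.I by
    push_cast; ring]
  exact Complex.norm_exp_ofReal_mul_I _

theorem conj_expChar (t : ℝ) : (starRingEnd ℂ) (expChar t) = expChar (-t) := by
  rw [expChar, expChar, ← Complex.exp_conj]; simp [Complex.conj_ofNat]

theorem expChar_sum {ι : Type*} (s : Finset ι) (f : ι → ℝ) :
    expChar (∑ i ∈ s, f i) = ∏ i ∈ s, expChar (f i) := by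
  classical
  induction s using Finset.induction_on with
  | empty => simp
  | insert a s ha ih => rw [Finset.sum_insert ha, Finset.prod_insert ha, expChar_add, ih]

theorem expChar_nat_mul (n : ℕ) (t : ℝ) : expChar (n * t) = expChar t ^ n := by
  rw [expChar, expChar, ← Complex.exp_nat_mul]; push_cast; ring_nf

theorem expChar_ne_one {t : ℝ} (ht : Irrational t) : expChar t ≠ 1 := by
  rw [expChar, Ne, Complex.exp_eq_one_iff]
  rintro ⟨n, hn⟩
  have hpi : (2 * Real.pi * Complex.I : ℂ) ≠ 0 := by
    simp [Real.pi_ne_zero]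
  have : (t : ℂ) = (n : ℂ) := by
    apply mul_right_cancel₀ hpi
    linear_combination hn
  exact ht ⟨n, by exact_mod_cast this.symm⟩

/-- The Cesàro average of the first `N` values of a sequence. -/
noncomputable def cesaro (a : ℕ → ℂ) (N : ℕ) : ℂ := (∑ n ∈ Finset.range N, a n) / N

theorem norm_cesaro_le {a : ℕ → ℂ} {C : ℝ} (hC : 0 ≤ C) (ha : ∀ n, ‖a n‖ ≤ C) (N : ℕ) :
    ‖cesaro a N‖ ≤ C := by
  rw [cesaro, norm_div, Complex.norm_natCast]
  rcases Nat.eq_zero_or_pos N with rfl | hN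
  · simpa using hC
  · rw [div_le_iff₀ (by exact_mod_cast hN)]
    calc _ ≤ ∑ n ∈ Finset.range N, ‖a n‖ := norm_sum_le _ _
      _ ≤ ∑ n ∈ Finset.range N, C := Finset.sum_le_sum fun n _ => ha n
      _ = C * N := by simp [mul_comm]

theorem cesaro_finset_sum {ι : Type*} (s : Finset ι) (a : ι → ℕ → ℂ) (N : ℕ) :
    cesaro (fun n => ∑ i ∈ s, a i n) N = ∑ i ∈ s, cesaro (a i) N := by
  simp only [cesaro]
  rw [Finset.sum_comm, Finset.sum_div]

theorem cesaro_const_mul (c : ℂ) (a : ℕ → ℂ) (N : ℕ) :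
    cesaro (fun n => c * a n) N = c * cesaro a N := by
  simp only [cesaro]
  rw [← Finset.mul_sum, mul_div_assoc]

theorem norm_cesaro_shift_sub_le {a : ℕ → ℂ} (ha : ∀ n, ‖a n‖ ≤ 1) (h N : ℕ) :
    ‖cesaro (fun n => a (n + h)) N - cesaro a N‖ ≤ 2 * h / N := by
  have key : ∑ n ∈ Finset.range N, a (n + h) - ∑ n ∈ Finset.range N, a n
      = ∑ n ∈ Finset.range h, a (N + n) - ∑ n ∈ Finset.range h, a n := by
    have h1 := Finset.sum_range_add a N h
    have h2 := Finset.sum_range_add a h N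
    rw [add_comm h N] at h2
    have h3 : ∑ n ∈ Finset.range N, a (n + h) = ∑ n ∈ Finset.range N, a (h + n) :=
      Finset.sum_congr rfl fun n _ => by rw [add_comm]
    rw [h3]
    linear_combination h1 - h2
  have bd : ∀ g : ℕ → ℂ, (∀ n, ‖g n‖ ≤ 1) → ‖∑ n ∈ Finset.range h, g n‖ ≤ h := fun g hg =>
    (norm_sum_le _ _).trans <| (Finset.sum_le_sum fun n _ => hg n).trans (by simp)
  rw [cesaro, cesaro, ← sub_div, key, norm_div, Complex.norm_natCast]
  gcongr
  calc _ ≤ _ := norm_sub_le _ _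
    _ ≤ h + h := add_le_add (bd _ fun n => ha _) (bd _ ha)
    _ = 2 * h := by ring

open Filter Topology in
/-- The lemma of van der Corput: a bounded sequence whose distinct shifts are asymptotically
orthogonal has mean zero. Each average is compared with the average of the means over `H`
consecutive shifts, whose mean square is `1 / H` in the limit. -/
theorem tendsto_cesaro_of_correlation {a : ℕ → ℂ} (ha : ∀ n, ‖a n‖ ≤ 1)
    (hcor : ∀ h h' : ℕ, h ≠ h' →
      Tendsto (cesaro fun n => a (n + h) * (starRingEnd ℂ) (a (n + h'))) atTop (𝓝 0)) :
    Tendsto (cesaro a) atTop (𝓝 0) := by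
  have main : ∀ H : ℕ, 0 < H → ∀ᶠ N in atTop, ‖cesaro a N‖ ≤ 1 / H + √(2 / H) := by
    intro H hH
    have hH' : (0 : ℝ) < H := by exact_mod_cast hH
    let b : ℕ → ℂ := fun n => ∑ h ∈ Finset.range H, a (n + h)
    have hdiff : ∀ N, ‖cesaro b N - H * cesaro a N‖ ≤ H * (2 * H / N) := by
      intro N
      have : cesaro b N - H * cesaro a N
          = ∑ h ∈ Finset.range H, (cesaro (fun n => a (n + h)) N - cesaro a N) := by
        rw [Finset.sum_sub_distrib, ← cesaro_finset_sum]; simp [b]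
      rw [this]
      calc _ ≤ ∑ h ∈ Finset.range H, ‖cesaro (fun n => a (n + h)) N - cesaro a N‖ :=
            norm_sum_le _ _
        _ ≤ ∑ h ∈ Finset.range H, (2 * H / N : ℝ) := Finset.sum_le_sum fun h hh =>
            (norm_cesaro_shift_sub_le ha h N).trans (by
              gcongr; exact (Finset.mem_range.mp hh).le)
        _ = _ := by simp
    have hsq : ∀ N, ‖cesaro b N‖ ^ 2
        ≤ ‖cesaro (fun n => b n * (starRingEnd ℂ) (b n)) N‖ := by
      intro N
      rcases Nat.eq_zero_or_pos N with rfl | hN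
      · simp [cesaro]
      have hN' : (0 : ℝ) < N := by exact_mod_cast hN
      have h1 : ∑ n ∈ Finset.range N, b n * (starRingEnd ℂ) (b n)
          = ((∑ n ∈ Finset.range N, ‖b n‖ ^ 2 : ℝ) : ℂ) := by
        push_cast
        exact Finset.sum_congr rfl fun n _ => Complex.mul_conj' _
      rw [cesaro, cesaro, h1, norm_div, norm_div, Complex.norm_natCast, Complex.norm_real,
        Real.norm_of_nonneg (Finset.sum_nonneg fun _ _ => sq_nonneg _), div_pow,
        div_le_div_iff₀ (by positivity) hN']
      have h2 : ‖∑ n ∈ Finset.range N, b n‖ ^ 2 ≤ N * ∑ n ∈ Finset.range N, ‖b n‖ ^ 2 := by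
        calc _ ≤ (∑ n ∈ Finset.range N, ‖b n‖) ^ 2 := by gcongr; exact norm_sum_le _ _
          _ ≤ _ := by
            have := sq_sum_le_card_mul_sum_sq (s := Finset.range N) (f := fun n => ‖b n‖)
            simpa using this
      nlinarith
    have hlim : Tendsto (fun N => cesaro (fun n => ∑ p ∈ Finset.range H ×ˢ Finset.range H,
        if p.1 = p.2 then 0 else a (n + p.1) * (starRingEnd ℂ) (a (n + p.2))) N) atTop (𝓝 0) := by
      have : Tendsto (fun N => ∑ p ∈ Finset.range H ×ˢ Finset.range H,
          cesaro (fun n => if p.1 = p.2 then 0 else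
            a (n + p.1) * (starRingEnd ℂ) (a (n + p.2))) N) atTop
          (𝓝 (∑ p ∈ Finset.range H ×ˢ Finset.range H, 0)) := by
        refine tendsto_finsetSum _ fun p _ => ?_
        by_cases hp : p.1 = p.2
        · simpa [hp] using (tendsto_const_nhds (x := (0 : ℂ))).congr fun N => by simp [cesaro]
        · simpa [hp] using hcor p.1 p.2 hp
      simp only [Finset.sum_const_zero] at this
      refine this.congr fun N => ?_
      rw [← cesaro_finset_sum]
    have hsplit : ∀ n, b n * (starRingEnd ℂ) (b n) =
        (∑ h ∈ Finset.range H, a (n + h) * (starRingEnd ℂ) (a (n + h))) +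
        ∑ p ∈ Finset.range H ×ˢ Finset.range H,
          if p.1 = p.2 then 0 else a (n + p.1) * (starRingEnd ℂ) (a (n + p.2)) := by
      intro n
      simp only [b, map_sum, Finset.sum_mul_sum]
      rw [Finset.sum_product, ← Finset.sum_add_distrib]
      refine Finset.sum_congr rfl fun h hh => ?_
      rw [← Finset.add_sum_erase _ _ hh, ← Finset.add_sum_erase (Finset.range H)
        (fun x => if (h, x).1 = (h, x).2 then (0 : ℂ) else _) hh]
      simp only [if_true, zero_add]
      congr 1
      exact Finset.sum_congr rfl fun x hx => by
        rw [if_neg (Finset.ne_of_mem_erase hx).symm]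
    have hev : ∀ᶠ N in atTop, ‖cesaro (fun n => ∑ p ∈ Finset.range H ×ˢ Finset.range H,
        if p.1 = p.2 then 0 else a (n + p.1) * (starRingEnd ℂ) (a (n + p.2))) N‖ < H := by
      have := hlim.norm
      rw [norm_zero] at this
      exact this.eventually (gt_mem_nhds hH')
    have hev2 : ∀ᶠ N : ℕ in atTop, (2 * H / N : ℝ) < 1 / H :=
      (tendsto_const_div_atTop_nhds_zero_nat (2 * H : ℝ)).eventually
        (gt_mem_nhds (by positivity))
    filter_upwards [hev, hev2] with N hN hN2
    have hb2 : ‖cesaro b N‖ ^ 2 ≤ 2 * H := by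
      refine (hsq N).trans ?_
      have : cesaro (fun n => b n * (starRingEnd ℂ) (b n)) N =
          cesaro (fun n => ∑ h ∈ Finset.range H, a (n + h) * (starRingEnd ℂ) (a (n + h))) N +
          cesaro (fun n => ∑ p ∈ Finset.range H ×ˢ Finset.range H,
            if p.1 = p.2 then 0 else a (n + p.1) * (starRingEnd ℂ) (a (n + p.2))) N := by
        simp only [cesaro, hsplit, Finset.sum_add_distrib, add_div]
      rw [this]
      refine (norm_add_le _ _).trans ?_
      have hdiag : ‖cesaro (fun n => ∑ h ∈ Finset.range H,
          a (n + h) * (starRingEnd ℂ) (a (n + h))) N‖ ≤ H := by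
        refine norm_cesaro_le hH'.le (fun n => (norm_sum_le _ _).trans ?_) N
        calc _ ≤ ∑ h ∈ Finset.range H, (1 : ℝ) := Finset.sum_le_sum fun h _ => by
              rw [norm_mul, RCLike.norm_conj]
              nlinarith [ha (n + h), norm_nonneg (a (n + h))]
          _ = H := by simp
      linarith
    have hb : ‖cesaro b N‖ ≤ √(2 * H) := Real.le_sqrt_of_sq_le hb2
    have hHa : H * ‖cesaro a N‖ ≤ √(2 * H) + H * (1 / H) := by
      have e : H * ‖cesaro a N‖ = ‖(H : ℂ) * cesaro a N‖ := by simp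
      rw [e]
      calc _ = ‖cesaro b N - (cesaro b N - H * cesaro a N)‖ := by congr 1; ring
        _ ≤ ‖cesaro b N‖ + ‖cesaro b N - H * cesaro a N‖ := norm_sub_le _ _
        _ ≤ _ := add_le_add hb ((hdiff N).trans (by gcongr))
    have hs : √(2 * H) = H * √(2 / H) := by
      rw [show (2 * H : ℝ) = H ^ 2 * (2 / H) by field_simp, Real.sqrt_mul (by positivity),
        Real.sqrt_sq hH'.le]
    rw [hs, ← mul_add] at hHa
    have := le_of_mul_le_mul_left hHa hH'
    linarith
  have hzero : Tendsto (fun H : ℕ => (1 / H + √(2 / H) : ℝ)) atTop (𝓝 0) := by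
    have h1 := tendsto_const_div_atTop_nhds_zero_nat (1 : ℝ)
    have h2 := (tendsto_const_div_atTop_nhds_zero_nat (2 : ℝ)).sqrt
    simpa using h1.add h2
  rw [tendsto_zero_iff_norm_tendsto_zero, Metric.tendsto_nhds]
  intro ε hε
  obtain ⟨H, hH1, hH2⟩ := ((hzero.eventually (gt_mem_nhds hε)).and (eventually_gt_atTop 0)).exists
  filter_upwards [main H hH2] with N hN
  simpa using hN.trans_lt hH1

open Filter Topology in
theorem tendsto_cesaro_pow {ζ : ℂ} (h1 : ‖ζ‖ = 1) (hne : ζ ≠ 1) :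
    Tendsto (cesaro fun n => ζ ^ n) atTop (𝓝 0) := by
  have hpos : 0 < ‖ζ - 1‖ := norm_pos_iff.mpr (sub_ne_zero.mpr hne)
  refine squeeze_zero_norm (a := fun N : ℕ => (2 / ‖ζ - 1‖) / N) (fun N => ?_)
    (tendsto_const_div_atTop_nhds_zero_nat _)
  rw [cesaro, geom_sum_eq hne, norm_div, norm_div, Complex.norm_natCast]
  gcongr
  refine (norm_sub_le _ _).trans ?_
  simp only [norm_pow, h1, one_pow, norm_one]; norm_num

open Filter Topology in
/-- Weyl's theorem for a polynomial with irrational leading coefficient. The correlations of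
`exp (2πi f(n))` are the same kind of sequence for the polynomials `f(n + h) - f(n + h')`, whose
degree is smaller by one. -/
theorem tendsto_cesaro_expChar_eval (D : ℕ) (f : ℝ[X]) (hdeg : f.natDegree = D + 1)
    (hlead : Irrational f.leadingCoeff) :
    Tendsto (cesaro fun n => expChar (f.eval (n : ℝ))) atTop (𝓝 0) := by
  induction D generalizing f with
  | zero =>
    have hf : ∀ n : ℕ, expChar (f.eval (n : ℝ))
        = expChar (f.coeff 0) * expChar (f.leadingCoeff) ^ n := by
      intro n
      rw [← expChar_nat_mul, ← expChar_add, leadingCoeff, hdeg,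
        eval_eq_sum_range, hdeg]
      simp [Finset.sum_range_succ]; ring_nf
    have h0 := (tendsto_cesaro_pow (norm_expChar _) (expChar_ne_one hlead)).const_mul
      (expChar (f.coeff 0))
    rw [mul_zero] at h0
    refine h0.congr fun N => ?_
    rw [← cesaro_const_mul]; simp only [hf]
  | succ D ih =>
    refine tendsto_cesaro_of_correlation (fun n => (norm_expChar _).le) fun h h' hne => ?_
    let g : ℝ[X] := taylor (h : ℝ) f - taylor (h' : ℝ) f
    have hcoeff : g.coeff (D + 1) = (D + 2 : ℕ) * f.leadingCoeff * ((h : ℝ) - h') := by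
      have aux : ∀ r : ℝ, (taylor r f).coeff (D + 1)
          = f.coeff (D + 1) + (D + 2 : ℕ) * f.leadingCoeff * r := by
        intro r
        rw [taylor_coeff, eval_eq_sum_range' (n := 2)]
        · simp only [hasseDeriv_coeff, leadingCoeff, hdeg, Finset.sum_range_succ,
            Finset.sum_range_zero]
          have : Nat.choose (1 + (D + 1)) (D + 1) = D + 2 := by
            rw [add_comm, Nat.choose_succ_self_right]
          have h2 : 1 + (D + 1) = D + 1 + 1 := by ring
          rw [this]
          simp only [h2, zero_add, Nat.choose_self]
          push_cast
          ring
        · refine lt_of_le_of_lt (natDegree_hasseDeriv_le f (D + 1)) (by omega)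
      simp only [g, coeff_sub, aux]; ring
    have hdegle : g.natDegree ≤ D + 1 := by
      refine natDegree_le_iff_coeff_eq_zero.mpr fun N hN => ?_
      rcases Nat.lt_or_ge N (D + 3) with hlt | hge
      · obtain rfl : N = D + 2 := by omega
        have aux : ∀ r : ℝ, (taylor r f).coeff (D + 2) = f.leadingCoeff := by
          intro r
          rw [← coeff_taylor_natDegree r f, hdeg]
        simp only [g, coeff_sub, aux, sub_self]
      · have aux : ∀ r : ℝ, (taylor r f).coeff N = 0 := fun r =>
          coeff_eq_zero_of_natDegree_lt (by rw [natDegree_taylor, hdeg]; omega)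
        simp only [g, coeff_sub, aux, sub_self]
    have hirr : Irrational (g.coeff (D + 1)) := by
      rw [hcoeff, show ((D + 2 : ℕ) * f.leadingCoeff * ((h : ℝ) - h') : ℝ)
        = f.leadingCoeff * (((D + 2 : ℕ) * ((h : ℤ) - h') : ℤ) : ℝ) by push_cast; ring]
      refine hlead.mul_intCast (mul_ne_zero (by positivity) (sub_ne_zero.mpr ?_))
      exact_mod_cast hne
    have hgdeg : g.natDegree = D + 1 :=
      le_antisymm hdegle (le_natDegree_of_ne_zero hirr.ne_zero)
    have := ih g hgdeg (by rw [leadingCoeff, hgdeg]; exact hirr)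
    convert this using 4 with n
    rw [conj_expChar, ← expChar_add]
    simp [g, taylor_eval, sub_eq_add_neg]

/-! ### Density of polynomial orbits on tori -/

theorem norm_sq_one_add_expChar (t : ℝ) :
    ‖1 + expChar t‖ ^ 2 = 2 + 2 * Real.cos (2 * Real.pi * t) := by
  rw [← Complex.normSq_eq_norm_sq, Complex.normSq_add, expChar,
    show (2 * Real.pi * t * Complex.I : ℂ) = ((2 * Real.pi * t : ℝ) : ℂ) * Complex.I by
      push_cast; ring, Complex.normSq_eq_norm_sq (Complex.exp _),
    Complex.norm_exp_ofReal_mul_I, map_one, one_mul, Complex.conj_re, Complex.exp_ofReal_mul_I_re]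
  ring

/-- The function `‖1 + exp (2πit)‖²` is at most `4`, and bounded away from `4` off any
neighbourhood of the integers. -/
theorem exists_norm_sq_one_add_expChar_le {ε : ℝ} (hε : 0 < ε) :
    ∃ ρ : ℝ, 0 ≤ ρ ∧ ρ < 4 ∧ ∀ t : ℝ, ε ≤ ‖(t : UnitAddCircle)‖ → ‖1 + expChar t‖ ^ 2 ≤ ρ := by
  have hδ : 0 < min ε (1 / 2) := by positivity
  set δ := min ε (1 / 2) with hδdef
  have hδ2 : δ ≤ 1 / 2 := min_le_right _ _
  refine ⟨2 + 2 * Real.cos (2 * Real.pi * δ), by linarith [Real.neg_one_le_cos (2 * Real.pi * δ)],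
    ?_, fun t ht => ?_⟩
  · have : Real.cos (2 * Real.pi * δ) < Real.cos 0 :=
      Real.cos_lt_cos_of_nonneg_of_le_pi le_rfl (by nlinarith [Real.pi_pos])
        (by nlinarith [Real.pi_pos])
    rw [Real.cos_zero] at this
    linarith
  · rw [norm_sq_one_add_expChar]
    rw [UnitAddCircle.norm_eq] at ht
    have h1 : Real.cos (2 * Real.pi * t) = Real.cos (2 * Real.pi * |t - round t|) := by
      rw [show 2 * Real.pi * |t - round t| = |2 * Real.pi * (t - round t)| by
        rw [abs_mul, abs_of_pos (by positivity : 0 < 2 * Real.pi)], Real.cos_abs,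
        show 2 * Real.pi * (t - round t) = 2 * Real.pi * t - (round t : ℤ) * (2 * Real.pi) by ring,
        Real.cos_sub_int_mul_two_pi]
    rw [h1]
    have h2 : Real.cos (2 * Real.pi * |t - round t|) ≤ Real.cos (2 * Real.pi * δ) := by
      have h3 := abs_sub_round t
      have h4 : δ ≤ |t - round t| := (min_le_left _ _).trans ht
      refine Real.cos_le_cos_of_nonneg_of_le_pi (by positivity) ?_ (by gcongr)
      nlinarith [Real.pi_pos]
    linarith

open Filter Topology in
/-- A sequence of points of a torus whose empirical averages of characters converge to
nonnegative limits comes arbitrarily close to `0`. The averages of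
`∏ i, ‖1 + exp (2πi z_i)‖ ^ (2M)` are bounded below by the diagonal terms of its Fourier expansion,
that is, by `4 ^ (M * card ι)` up to a polynomial factor in `M`; this exceeds exponentially the
values of the function off a neighbourhood of `0`. -/
theorem exists_norm_lt_of_tendsto_cesaro {ι : Type*} [Fintype ι] (z : ℕ → ι → ℝ)
    (c : (ι → ℤ) → ℝ) (hc : ∀ u, 0 ≤ c u) (hc0 : c 0 = 1)
    (hlim : ∀ u : ι → ℤ, Tendsto (cesaro fun n => expChar (∑ i, u i * z n i)) atTop (𝓝 (c u)))
    {ε : ℝ} (hε : 0 < ε) : ∃ n, ∀ i, ‖(z n i : UnitAddCircle)‖ < ε := by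
  classical
  by_contra! hcon
  obtain ⟨ρ, hρ0, hρ4, hρ⟩ := exists_norm_sq_one_add_expChar_le hε
  set m := Fintype.card ι with hm
  have key : ∀ M : ℕ, (4 : ℝ) ^ (M * m) ≤ (M + 1) ^ m * (ρ ^ M * 4 ^ (M * (m - 1))) := by
    intro M
    let S : Finset (ι → ℕ) := Fintype.piFinset fun _ => Finset.range (M + 1)
    let w : (ι → ℕ) → ℝ := fun k => ∏ i, (M.choose (k i) : ℝ)
    have hw : ∀ k, 0 ≤ w k := fun k => Finset.prod_nonneg fun i _ => by positivity
    let E : ℕ → ℂ := fun n => ∏ i, (1 + expChar (z n i)) ^ M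
    have hE : ∀ n, E n = ∑ k ∈ S, (w k : ℂ) * expChar (∑ i, k i * z n i) := by
      intro n
      have : ∀ i, (1 + expChar (z n i)) ^ M
          = ∑ j ∈ Finset.range (M + 1), (M.choose j : ℂ) * expChar (j * z n i) := by
        intro i
        rw [add_comm, add_pow]
        refine Finset.sum_congr rfl fun j _ => ?_
        rw [expChar_nat_mul]; ring
      simp only [E, this]
      rw [Finset.prod_univ_sum]
      refine Finset.sum_congr rfl fun k _ => ?_
      rw [expChar_sum, Finset.prod_mul_distrib]
      simp [w]
    have hEE : ∀ n, E n * (starRingEnd ℂ) (E n) = ∑ p ∈ S ×ˢ S, ((w p.1 * w p.2 : ℝ) : ℂ) *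
        expChar (∑ i, (((p.1 i : ℤ) - (p.2 i : ℤ) : ℤ) : ℝ) * z n i) := by
      intro n
      rw [hE, map_sum, Finset.sum_mul_sum, Finset.sum_product]
      refine Finset.sum_congr rfl fun k _ => Finset.sum_congr rfl fun l _ => ?_
      rw [map_mul, conj_expChar, Complex.conj_ofReal]
      have : ∑ i, (((k i : ℤ) - (l i : ℤ) : ℤ) : ℝ) * z n i
          = ∑ i, k i * z n i + -∑ i, l i * z n i := by
        push_cast
        simp only [sub_mul, Finset.sum_sub_distrib]; ring
      rw [this, expChar_add]; push_cast; ring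
    have hupper : ∀ n, ‖E n * (starRingEnd ℂ) (E n)‖ ≤ ρ ^ M * 4 ^ (M * (m - 1)) := by
      intro n
      obtain ⟨i, hi⟩ := hcon n
      have h1 : ‖E n * (starRingEnd ℂ) (E n)‖ = ∏ i, (‖1 + expChar (z n i)‖ ^ 2) ^ M := by
        rw [norm_mul, RCLike.norm_conj, norm_prod, ← Finset.prod_mul_distrib]
        refine Finset.prod_congr rfl fun j _ => ?_
        rw [norm_pow]; ring
      rw [h1, ← Finset.mul_prod_erase _ _ (Finset.mem_univ i)]
      have h4 : ∀ t, ‖1 + expChar t‖ ^ 2 ≤ 4 := fun t => by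
        rw [norm_sq_one_add_expChar]; linarith [Real.cos_le_one (2 * Real.pi * t)]
      gcongr
      · exact hρ _ hi
      · calc _ ≤ ∏ j ∈ Finset.univ.erase i, (4 : ℝ) ^ M :=
              Finset.prod_le_prod (fun _ _ => by positivity) fun j _ => by
                gcongr; exact h4 _
          _ = _ := by
            rw [Finset.prod_const, Finset.card_erase_of_mem (Finset.mem_univ i),
              Finset.card_univ, ← pow_mul]
    have hlimE : Tendsto (cesaro fun n => E n * (starRingEnd ℂ) (E n)) atTop
        (𝓝 (∑ p ∈ S ×ˢ S, ((w p.1 * w p.2 : ℝ) : ℂ) * c fun i => (p.1 i : ℤ) - p.2 i)) := by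
      have := tendsto_finsetSum (S ×ˢ S) fun p _ =>
        (hlim fun i => (p.1 i : ℤ) - p.2 i).const_mul ((w p.1 * w p.2 : ℝ) : ℂ)
      refine this.congr fun N => ?_
      simp only [hEE]
      rw [cesaro_finset_sum]
      simp only [cesaro_const_mul]
    have hbound : ∑ p ∈ S ×ˢ S, w p.1 * w p.2 * c (fun i => (p.1 i : ℤ) - p.2 i)
        ≤ ρ ^ M * 4 ^ (M * (m - 1)) := by
      have h1 := le_of_tendsto hlimE.norm (Eventually.of_forall fun N =>
        norm_cesaro_le (by positivity) hupper N)
      refine le_trans (le_trans (le_abs_self _) (le_of_eq ?_)) h1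
      rw [← Real.norm_eq_abs, ← Complex.norm_real]
      push_cast; rfl
    have hdiag : ∑ k ∈ S, w k ^ 2 ≤
        ∑ p ∈ S ×ˢ S, w p.1 * w p.2 * c (fun i => (p.1 i : ℤ) - p.2 i) := by
      rw [Finset.sum_product]
      refine Finset.sum_le_sum fun k hk => ?_
      have := Finset.single_le_sum (f := fun l => w k * w l * c (fun i => (k i : ℤ) - l i))
        (fun l _ => mul_nonneg (mul_nonneg (hw k) (hw l)) (hc _)) hk
      refine le_trans (le_of_eq ?_) this
      simp only [sub_self]
      rw [show (fun _ : ι => (0 : ℤ)) = 0 from rfl, hc0]; ring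
    have hsumw : ∑ k ∈ S, w k = 2 ^ (M * m) := by
      simp only [S, w]
      rw [← Finset.prod_univ_sum (fun _ => Finset.range (M + 1)) fun _ j => (M.choose j : ℝ)]
      have : ∑ j ∈ Finset.range (M + 1), (M.choose j : ℝ) = 2 ^ M := by
        exact_mod_cast Nat.sum_range_choose M
      simp [this, ← pow_mul, hm]
    have hcs := sq_sum_le_card_mul_sum_sq (s := S) (f := w)
    have hcard : (S.card : ℝ) = (M + 1) ^ m := by
      simp [S, Fintype.card_piFinset, hm]
    rw [hsumw, hcard] at hcs
    calc (4 : ℝ) ^ (M * m) = (2 ^ (M * m)) ^ 2 := by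
          rw [← pow_mul, mul_comm _ 2, pow_mul 2 2]; norm_num
      _ ≤ _ := hcs
      _ ≤ _ := by gcongr; exact hdiag.trans hbound
  have hmpos : 0 < m := by
    obtain ⟨i, _⟩ := hcon 0
    exact Fintype.card_pos_iff.mpr ⟨i⟩
  have key2 : ∀ M : ℕ, 1 ≤ ((M + 1 : ℕ) : ℝ) ^ m * (ρ / 4) ^ M := by
    intro M
    have h1 := key M
    obtain ⟨m', hm'⟩ : ∃ m', m = m' + 1 := ⟨m - 1, by omega⟩
    rw [hm'] at h1 ⊢
    rw [Nat.add_sub_cancel, mul_add, mul_one, pow_add] at h1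
    rw [div_pow, mul_div_assoc', le_div_iff₀ (by positivity), one_mul]
    have h2 : (0 : ℝ) < 4 ^ (M * m') := by positivity
    refine le_of_mul_le_mul_left ?_ h2
    calc _ ≤ _ := h1
      _ = _ := by push_cast; ring
  have hr : |ρ / 4| < 1 := by rw [abs_of_nonneg (by positivity)]; linarith
  have htend := tendsto_pow_const_mul_const_pow_of_abs_lt_one m hr
  have h1 : Tendsto (fun M : ℕ => (ρ / 4) * (((M + 1 : ℕ) : ℝ) ^ m * (ρ / 4) ^ M)) atTop (𝓝 0) := by
    refine ((tendsto_add_atTop_iff_nat 1).mpr htend).congr fun M => ?_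
    rw [pow_succ (ρ / 4)]; ring
  have h2 : ρ / 4 ≤ 0 := ge_of_tendsto h1 (Eventually.of_forall fun M => by
    nlinarith [key2 M])
  have hρz : ρ = 0 := by linarith
  have := key2 1
  rw [hρz] at this
  norm_num at this

/-- The rational numbers in a finitely generated subgroup of `ℝ` have a common denominator. -/
theorem exists_common_denominator (S : Finset ℝ) :
    ∃ Q : ℕ, 0 < Q ∧ ∀ x ∈ Submodule.span ℤ (S : Set ℝ), ¬ Irrational x → ∃ z : ℤ, Q * x = z := by
  let V : Submodule ℤ ℝ := Submodule.span ℤ (S : Set ℝ)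
  let R : Submodule ℤ ℝ := LinearMap.range ((Rat.castHom ℝ).toAddMonoidHom.toIntLinearMap)
  have hV : IsNoetherian ℤ V := isNoetherian_span_of_finite ℤ S.finite_toSet
  have hfg : (V ⊓ R).FG := by
    have := (isNoetherian_submodule.mp hV) (V ⊓ R) inf_le_left
    exact this
  obtain ⟨G, hG⟩ := hfg
  have hden : ∀ g ∈ G, ∃ q : ℚ, (q : ℝ) = g := by
    intro g hg
    have : g ∈ V ⊓ R := hG ▸ Submodule.subset_span hg
    obtain ⟨q, hq⟩ := this.2
    exact ⟨q, hq⟩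
  choose! q hq using hden
  refine ⟨∏ g ∈ G, (q g).den, Finset.prod_pos fun g _ => (q g).den_pos, fun x hx hirr => ?_⟩
  have hxR : x ∈ V ⊓ R := by
    refine ⟨hx, ?_⟩
    obtain ⟨r, hr⟩ := not_not.mp hirr
    exact ⟨r, hr⟩
  rw [← hG] at hxR
  clear hx hirr
  induction hxR using Submodule.span_induction with
  | mem g hg =>
    obtain ⟨k, hk⟩ := Finset.dvd_prod_of_mem (fun g => (q g).den) hg
    refine ⟨k * (q g).num, ?_⟩
    rw [hk]
    nth_rewrite 2 [← hq g hg]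
    have : ((q g).den : ℝ) * (q g : ℝ) = (q g).num := by
      exact_mod_cast Rat.den_mul_eq_num (q g)
    push_cast
    linear_combination (k : ℝ) * this
  | zero => exact ⟨0, by simp⟩
  | add x y _ _ ihx ihy =>
    obtain ⟨a, ha⟩ := ihx
    obtain ⟨b, hb⟩ := ihy
    exact ⟨a + b, by push_cast at *; rw [mul_add, ha, hb]⟩
  | smul n x _ ih =>
    obtain ⟨a, ha⟩ := ih
    exact ⟨n * a, by push_cast at *; rw [← ha, zsmul_eq_mul]; ring⟩

open Filter Topology in
/-- If each coefficient of `f` is irrational or an integer and some nonconstant one is irrational,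
the averages of `exp (2πi f(n))` over the positive integers `n` tend to zero: the integer
coefficients above the last irrational one do not matter modulo `1`. -/
theorem tendsto_cesaro_expChar_of_irrational_or_int (f : ℝ[X])
    (hf : ∀ m, Irrational (f.coeff m) ∨ ∃ z : ℤ, f.coeff m = z)
    (hirr : ∃ m, 0 < m ∧ Irrational (f.coeff m)) :
    Tendsto (cesaro fun n => expChar (f.eval ((n : ℝ) + 1))) atTop (𝓝 0) := by
  induction hn : f.support.card generalizing f with
  | zero =>
    obtain ⟨m, -, hm⟩ := hirr
    rw [Finset.card_eq_zero, support_eq_empty] at hn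
    simp [hn] at hm
  | succ N ih =>
    obtain ⟨m, hm0, hm⟩ := hirr
    have hmdeg : m ≤ f.natDegree := le_natDegree_of_ne_zero hm.ne_zero
    rcases hf f.natDegree with hlead | ⟨z, hz⟩
    · have h1 := tendsto_cesaro_expChar_eval (f.natDegree - 1) (taylor 1 f)
        (by rw [natDegree_taylor]; omega) (by rwa [leadingCoeff_taylor])
      simpa [taylor_eval] using h1
    · have hcoeff : ∀ j, f.eraseLead.coeff j = if j = f.natDegree then 0 else f.coeff j :=
        fun j => eraseLead_coeff j
      have h1 := ih f.eraseLead (fun j => by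
        rw [hcoeff]
        split_ifs with h
        · exact Or.inr ⟨0, by simp⟩
        · exact hf j) ⟨m, hm0, by
          rw [hcoeff, if_neg]
          · exact hm
          · rintro rfl
            exact hm ⟨z, by rw [hz]; simp⟩⟩ (card_support_eraseLead' hn)
      refine h1.congr fun K => ?_
      congr 1
      funext n
      conv_rhs => rw [← eraseLead_add_monomial_natDegree_leadingCoeff f]
      rw [eval_add, expChar_add, eval_monomial, leadingCoeff, hz]
      have : expChar ((z : ℝ) * ((n : ℝ) + 1) ^ f.natDegree) = 1 := by
        have := expChar_intCast (z * (n + 1) ^ f.natDegree)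
        push_cast at this
        exact this
      rw [this, mul_one]

open Filter Topology in
/-- The closure of a polynomial orbit on a torus: it contains each point killed by all characters
along which the orbit is a polynomial with rational coefficients. Restricting `n` to the multiples
of a common denominator `Q`, every character has mean `0` or `1` along the orbit. -/
theorem exists_norm_eval_sub_lt {ι : Type*} [Fintype ι] (P : ι → ℝ[X])
    (h0 : ∀ i, (P i).coeff 0 = 0) (y : ι → ℝ)
    (hy : ∀ u : ι → ℤ, (∀ m, ¬ Irrational (∑ i, u i * (P i).coeff m)) →
      ∃ z : ℤ, ∑ i, u i * y i = z)
    {ε : ℝ} (hε : 0 < ε) :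
    ∃ n : ℕ, 0 < n ∧ ∀ i, ‖(((P i).eval (n : ℝ) - y i : ℝ) : UnitAddCircle)‖ < ε := by
  classical
  let S : Finset ℝ := Finset.univ.biUnion fun i => (P i).coeffs
  obtain ⟨Q, hQ, hQS⟩ := exists_common_denominator S
  have hspan : ∀ (u : ι → ℤ) (m : ℕ),
      ∑ i, u i * (P i).coeff m ∈ Submodule.span ℤ (S : Set ℝ) := by
    intro u m
    refine Submodule.sum_mem _ fun i _ => ?_
    rw [← zsmul_eq_mul]
    refine Submodule.smul_mem _ _ ?_
    by_cases h : (P i).coeff m = 0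
    · rw [h]; exact Submodule.zero_mem _
    · exact Submodule.subset_span (Finset.mem_coe.mpr (Finset.mem_biUnion.mpr
        ⟨i, Finset.mem_univ i, coeff_mem_coeffs h⟩))
  let F : (ι → ℤ) → ℝ[X] := fun u => (∑ i, C (u i : ℝ) * P i).comp (C (Q : ℝ) * X)
  have hFc : ∀ u m, (F u).coeff m = (∑ i, u i * (P i).coeff m) * (Q : ℝ) ^ m := by
    intro u m
    simp only [F]
    rw [comp_C_mul_X_coeff, finsetSum_coeff]
    simp
  have hFe : ∀ u (x : ℝ), (F u).eval x = ∑ i, u i * (P i).eval (Q * x) := by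
    intro u x
    simp [F, eval_comp, eval_finsetSum]
  have hFint : ∀ u m, Irrational ((F u).coeff m) ∨ ∃ z : ℤ, (F u).coeff m = z := by
    intro u m
    rw [hFc]
    by_cases hi : Irrational (∑ i, u i * (P i).coeff m)
    · left
      have := hi.mul_natCast (m := Q ^ m) (by positivity)
      push_cast at this
      exact this
    · right
      rcases Nat.eq_zero_or_pos m with rfl | hm
      · exact ⟨0, by simp [h0]⟩
      · obtain ⟨z, hz⟩ := hQS _ (hspan u m) hi
        obtain ⟨k, rfl⟩ : ∃ k, m = k + 1 := ⟨m - 1, by omega⟩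
        exact ⟨z * Q ^ k, by push_cast; rw [← hz]; ring⟩
  let z : ℕ → ι → ℝ := fun n i => (P i).eval (Q * ((n : ℝ) + 1)) - y i
  have hz : ∀ u n, ∑ i, u i * z n i = (F u).eval ((n : ℝ) + 1) + -∑ i, u i * y i := by
    intro u n
    rw [hFe]
    simp only [z, mul_sub, Finset.sum_sub_distrib]; ring
  let c : (ι → ℤ) → ℝ := fun u => if ∃ m, 0 < m ∧ Irrational ((F u).coeff m) then 0 else 1
  have hlim : ∀ u : ι → ℤ,
      Tendsto (cesaro fun n => expChar (∑ i, u i * z n i)) atTop (𝓝 (c u)) := by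
    intro u
    by_cases hu : ∃ m, 0 < m ∧ Irrational ((F u).coeff m)
    · have h1 := (tendsto_cesaro_expChar_of_irrational_or_int (F u) (hFint u) hu).const_mul
        (expChar (-∑ i, u i * y i))
      simp only [c, if_pos hu]
      rw [mul_zero] at h1
      refine (h1.congr fun N => ?_)
      rw [← cesaro_const_mul]
      congr 1
      funext n
      rw [hz, expChar_add, mul_comm]
    · simp only [c, if_neg hu]
      have hrat : ∀ m, ¬ Irrational (∑ i, u i * (P i).coeff m) := by
        intro m hi
        rcases Nat.eq_zero_or_pos m with rfl | hm
        · simp [h0] at hi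
        · refine hu ⟨m, hm, ?_⟩
          rw [hFc]
          have := hi.mul_natCast (m := Q ^ m) (by positivity)
          push_cast at this
          exact this
      obtain ⟨a, ha⟩ := hy u hrat
      have hone : ∀ n, expChar (∑ i, u i * z n i) = 1 := by
        intro n
        rw [hz, ha]
        have hcoef : ∀ m, ∃ z : ℤ, (F u).coeff m = z := by
          intro m
          refine (hFint u m).resolve_left fun hi => ?_
          rw [hFc] at hi
          exact hrat m (by
            by_contra hcon
            obtain ⟨q, hq⟩ := not_not.mp hcon
            exact hi ⟨q * Q ^ m, by push_cast; rw [hq]⟩)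
        choose b hb using hcoef
        have : (F u).eval ((n : ℝ) + 1) + -(a : ℝ) =
            ((∑ m ∈ Finset.range ((F u).natDegree + 1), b m * ((n : ℤ) + 1) ^ m - a : ℤ) : ℝ) := by
          rw [eval_eq_sum_range]
          push_cast
          simp only [hb]; ring
        rw [this, expChar_intCast]
      simp only [hone]
      refine (tendsto_const_nhds (x := (1 : ℂ))).congr' ?_ |>.trans (by simp)
      filter_upwards [eventually_gt_atTop 0] with N hN
      have : (N : ℂ) ≠ 0 := by exact_mod_cast hN.ne'
      simp [cesaro, this]
  obtain ⟨n, hn⟩ := exists_norm_lt_of_tendsto_cesaro z c (fun u => by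
    simp only [c]; split_ifs <;> norm_num) (by
    simp only [c]
    rw [if_neg]
    rintro ⟨m, -, hm⟩
    rw [hFc] at hm
    simp at hm) hlim hε
  refine ⟨Q * (n + 1), by positivity, fun i => ?_⟩
  have := hn i
  simp only [z] at this
  push_cast
  exact this

/-! ### Powers of unipotent affine maps -/

/-- The strictly lower triangular part of an integer matrix, over a ring `S`. A quasi-standard Weyl
system is the affine map `x ↦ x + N x + α` where `N` is this part of its matrix. -/
def strictLower {d : ℕ} (S : Type*) [Ring S] (M : Matrix (Fin d) (Fin d) ℤ) :
    Matrix (Fin d) (Fin d) S :=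
  Matrix.of fun i j => if j < i then (M i j : S) else 0

theorem strictLower_apply {d : ℕ} (S : Type*) [Ring S] (M : Matrix (Fin d) (Fin d) ℤ)
    (i j : Fin d) :
    strictLower S M i j = if j < i then (M i j : S) else 0 := rfl

theorem strictLower_map {d : ℕ} {S S' : Type*} [Ring S] [Ring S'] (φ : S →+* S')
    (M : Matrix (Fin d) (Fin d) ℤ) : (strictLower S M).map φ = strictLower S' M := by
  ext i j
  rw [Matrix.map_apply, strictLower_apply, strictLower_apply]
  split_ifs <;> simp

open Matrix in
/-- A vector whose entries with index at least `m` vanish is moved by `v ↦ v N ^ k` to one whose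
entries with index at least `m - k` vanish. -/
theorem vecMul_strictLower_pow_eq_zero {d : ℕ} {S : Type*} [Ring S] (M : Matrix (Fin d) (Fin d) ℤ)
    (v : Fin d → S) (m k : ℕ) (hv : ∀ l : Fin d, m ≤ l.val → v l = 0) (l : Fin d)
    (hl : m ≤ l.val + k) : (v ᵥ* strictLower S M ^ k) l = 0 := by
  induction k generalizing l with
  | zero => simpa using hv l hl
  | succ k ih =>
    rw [pow_succ, ← vecMul_vecMul, vecMul, dotProduct]
    refine Finset.sum_eq_zero fun s _ => ?_
    rw [strictLower_apply]
    split_ifs with h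
    · rw [ih s (by have : l.val < s.val := h; omega), zero_mul]
    · rw [mul_zero]

theorem strictLower_pow_eq_zero {d : ℕ} {S : Type*} [Ring S] (M : Matrix (Fin d) (Fin d) ℤ) :
    strictLower S M ^ d = 0 := by
  ext i j
  have := vecMul_strictLower_pow_eq_zero M (Pi.single i (1 : S)) d d
    (fun l hl => absurd l.isLt (by omega)) j (by omega)
  simpa using this

/-- The binomial coefficient `X.choose k` as a polynomial. -/
noncomputable def binomPoly (k : ℕ) : ℚ[X] := C ((k.factorial : ℚ)⁻¹) * descPochhammer ℚ k

theorem binomPoly_zero : binomPoly 0 = 1 := by simp [binomPoly]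

theorem binomPoly_eval_zero (k : ℕ) : (binomPoly (k + 1)).eval 0 = 0 := by
  simp [binomPoly, descPochhammer_ne_zero_eval_zero]

theorem binomPoly_eval_add_one (k : ℕ) (z : ℚ) :
    (binomPoly (k + 1)).eval (z + 1) = (binomPoly (k + 1)).eval z + (binomPoly k).eval z := by
  have h := congrArg (eval (z + 1)) (descPochhammer_succ_comp_X_sub_one (R := ℚ) k)
  simp only [eval_comp, eval_sub, eval_X, eval_one, add_sub_cancel_right, smul_eq_mul,
    eval_mul, eval_add, eval_natCast] at h
  have hk : ((k : ℚ) + 1) ≠ 0 := by positivity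
  have hf : ((k.factorial : ℚ)) ≠ 0 := by positivity
  simp only [binomPoly, eval_mul, eval_C, Nat.factorial_succ]
  push_cast at h ⊢
  field_simp
  linear_combination -h

open Matrix in
/-- The point `x + ∑ k, b k • N ^ k (N x + α)`. For `b k = z.choose (k + 1)` it is the image of `x`
under the `z`-th power of `x ↦ x + N x + α`. The ring is arbitrary so that `x` and `b` can be
polynomials. -/
def unipotentOrbit {d : ℕ} {S : Type*} [CommRing S] (M : Matrix (Fin d) (Fin d) ℤ) (α : Fin d → S)
    (b : ℕ → S) (x : Fin d → S) : Fin d → S :=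
  x + ∑ k ∈ Finset.range d, b k • (strictLower S M ^ k *ᵥ (strictLower S M *ᵥ x + α))

open Matrix in
theorem unipotentOrbit_step {d : ℕ} {S : Type*} [CommRing S] (M : Matrix (Fin d) (Fin d) ℤ)
    (α : Fin d → S) (b b' : ℕ → S) (h0 : b' 0 = b 0 + 1) (h : ∀ k, b' (k + 1) = b (k + 1) + b k)
    (x : Fin d → S) :
    unipotentOrbit M α b' x = unipotentOrbit M α b x
      + strictLower S M *ᵥ unipotentOrbit M α b x + α := by
  set N := strictLower S M with hN
  set v := N *ᵥ x + α with hv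
  have hd : N ^ d = 0 := strictLower_pow_eq_zero M
  have key : ∀ n, ∑ k ∈ Finset.range (n + 1), b' k • (N ^ k *ᵥ v)
      = ∑ k ∈ Finset.range (n + 1), b k • (N ^ k *ᵥ v)
        + (v + ∑ k ∈ Finset.range n, b k • (N ^ (k + 1) *ᵥ v)) := by
    intro n
    rw [Finset.sum_range_succ', Finset.sum_range_succ' (fun k => b k • (N ^ k *ᵥ v))]
    simp only [h, h0, add_smul, Finset.sum_add_distrib, pow_zero, one_mulVec, one_smul]
    abel
  have hlast : ∀ c : ℕ → S, ∑ k ∈ Finset.range (d + 1), c k • (N ^ k *ᵥ v)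
      = ∑ k ∈ Finset.range d, c k • (N ^ k *ᵥ v) := by
    intro c
    rw [Finset.sum_range_succ, hd, zero_mulVec, smul_zero, add_zero]
  have hmul : N *ᵥ (x + ∑ k ∈ Finset.range d, b k • (N ^ k *ᵥ v))
      = N *ᵥ x + ∑ k ∈ Finset.range d, b k • (N ^ (k + 1) *ᵥ v) := by
    rw [mulVec_add]
    congr 1
    rw [← mulVecLin_apply, map_sum]
    refine Finset.sum_congr rfl fun k _ => ?_
    rw [mulVecLin_apply, mulVec_smul, mulVec_mulVec, pow_succ']
  have hk := key d
  rw [hlast, hlast] at hk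
  simp only [unipotentOrbit, ← hN, ← hv]
  rw [hmul, hk, hv]
  abel

open Matrix in
theorem map_unipotentOrbit {d : ℕ} {S S' : Type*} [CommRing S] [CommRing S'] (φ : S →+* S')
    (M : Matrix (Fin d) (Fin d) ℤ) (α : Fin d → S) (b : ℕ → S) (x : Fin d → S) (l : Fin d) :
    φ (unipotentOrbit M α b x l)
      = unipotentOrbit M (fun i => φ (α i)) (fun k => φ (b k)) (fun i => φ (x i)) l := by
  have hvec : (φ ∘ (strictLower S M *ᵥ x + α))
      = strictLower S' M *ᵥ (fun i => φ (x i)) + fun i => φ (α i) := by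
    funext i
    simp only [Function.comp_apply, Pi.add_apply, map_add, RingHom.map_mulVec, strictLower_map]
    rfl
  simp only [unipotentOrbit, Pi.add_apply, map_add, Finset.sum_apply, Pi.smul_apply, map_sum,
    smul_eq_mul, map_mul, RingHom.map_mulVec, hvec]
  congr 1
  refine Finset.sum_congr rfl fun k _ => ?_
  rw [show (strictLower S M ^ k).map φ = strictLower S' M ^ k by
    rw [← strictLower_map φ M]; exact map_pow φ.mapMatrix (strictLower S M) k]

open Matrix in
theorem weylMap_coe {d : ℕ} (α : Fin d → ℝ) (M : Matrix (Fin d) (Fin d) ℤ) (x : Fin d → ℝ) :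
    weylMap α M (fun i => (x i : UnitAddCircle))
      = fun i => ((x + strictLower ℝ M *ᵥ x + α) i : UnitAddCircle) := by
  funext i
  have : (strictLower ℝ M *ᵥ x) i = ∑ j ∈ Finset.Iio i, M i j • x j := by
    simp only [mulVec, dotProduct, strictLower_apply, ite_mul, zero_mul, zsmul_eq_mul]
    rw [← Finset.sum_filter]
    refine Finset.sum_congr ?_ fun _ _ => rfl
    ext j; simp
  simp only [weylMap, Pi.add_apply, this, AddCircle.coe_add]
  congr 2
  simp only [← AddCircle.coe_zsmul]
  exact (map_sum (QuotientAddGroup.mk' (AddSubgroup.zmultiples (1 : ℝ))) _ _).symm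

theorem zpow_apply_of_step {Y : Type*} (T : Equiv.Perm Y) (φ : ℤ → Y)
    (h : ∀ z, φ (z + 1) = T (φ z)) (z : ℤ) : (T ^ z) (φ 0) = φ z := by
  induction z using Int.induction_on with
  | zero => simp
  | succ n ih => rw [add_comm, zpow_add, zpow_one, Equiv.Perm.mul_apply, ih, ← h, add_comm]
  | pred n ih =>
    have h1 := h (-(n : ℤ) - 1)
    rw [sub_add_cancel] at h1
    rw [sub_eq_add_neg, add_comm, zpow_add, zpow_neg, zpow_one, Equiv.Perm.mul_apply, ih, h1,
      ← Equiv.Perm.mul_apply, inv_mul_cancel, Equiv.Perm.one_apply, add_comm, ← sub_eq_add_neg]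

open Matrix in
theorem weylEquiv_zpow_coe {d : ℕ} (α : Fin d → ℝ) (M : Matrix (Fin d) (Fin d) ℤ) (x : Fin d → ℝ)
    (z : ℤ) : (weylEquiv α M ^ z) (fun i => (x i : UnitAddCircle))
      = fun i => ((unipotentOrbit M α (fun k => (((binomPoly (k + 1)).eval (z : ℚ) : ℚ) : ℝ)) x i : ℝ)
          : UnitAddCircle) := by
  have h := zpow_apply_of_step (weylEquiv α M)
    (fun z : ℤ => fun i =>
      ((unipotentOrbit M α (fun k => (((binomPoly (k + 1)).eval (z : ℚ) : ℚ) : ℝ)) x i : ℝ)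
        : UnitAddCircle)) (fun z => by
      rw [show (weylEquiv α M) = Equiv.ofBijective (weylMap α M) (weylMap_bijective α M) from rfl,
        Equiv.ofBijective_apply, weylMap_coe]
      funext i
      rw [unipotentOrbit_step M α
        (fun k => (((binomPoly (k + 1)).eval (z : ℚ) : ℚ) : ℝ))
        (fun k => (((binomPoly (k + 1)).eval ((z + 1 : ℤ) : ℚ) : ℚ) : ℝ))]
      · push_cast
        rw [binomPoly_eval_add_one]; simp [binomPoly_zero]
      · intro k
        push_cast
        rw [binomPoly_eval_add_one]; push_cast; rfl) z
  rw [← h]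
  congr 1
  funext i
  simp [binomPoly_eval_zero, unipotentOrbit]

/-! ### Characters annihilating the orbit -/

open Matrix in
/-- The row vector `R` of polynomials such that the sum over `i` of the characters `u i` evaluated
at `T ^ (F i (n)) x - x` is `R(n) (N x + α)`. -/
noncomputable def charRow {d K : ℕ} (M : Matrix (Fin d) (Fin d) ℤ) (F : Fin K → ℤ[X])
    (u : Fin K → Fin d → ℤ) : Fin d → ℚ[X] :=
  ∑ i, ∑ k ∈ Finset.range d, (binomPoly (k + 1)).comp ((F i).map (Int.castRingHom ℚ)) •
    ((fun l => C (u i l : ℚ)) ᵥ* strictLower ℚ[X] M ^ k)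

open Matrix in
theorem dotProduct_unipotentOrbit {d : ℕ} {S : Type*} [CommRing S] (M : Matrix (Fin d) (Fin d) ℤ)
    (α : Fin d → S) (b : ℕ → S) (x u : Fin d → S) :
    u ⬝ᵥ unipotentOrbit M α b x = u ⬝ᵥ x
      + (∑ k ∈ Finset.range d, b k • (u ᵥ* strictLower S M ^ k)) ⬝ᵥ (strictLower S M *ᵥ x + α) := by
  rw [unipotentOrbit, dotProduct_add]
  congr 1
  rw [dotProduct_sum, sum_dotProduct]
  refine Finset.sum_congr rfl fun k _ => ?_
  rw [dotProduct_smul, smul_dotProduct, dotProduct_mulVec]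

open Matrix in
theorem eq_zero_of_vecMul_strictLower_eq_zero {d : ℕ} {S : Type*} [CommRing S] [IsDomain S]
    [CharZero S] (M : Matrix (Fin d) (Fin d) ℤ)
    (hM : ∀ i j : Fin d, j.val + 1 = i.val → M i j ≠ 0) (R : Fin d → S)
    (hR : R ᵥ* strictLower S M = 0) (s : Fin d) (hs : 0 < s.val) : R s = 0 := by
  induction s using WellFoundedGT.induction with
  | ind s ih =>
    have hj : s.val - 1 < d := by omega
    have h := congrFun hR ⟨s.val - 1, hj⟩
    rw [vecMul, dotProduct, Finset.sum_eq_single s] at h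
    · rw [strictLower_apply, if_pos (Fin.lt_def.mpr (by simp only; omega)), Pi.zero_apply] at h
      refine (mul_eq_zero.mp h).resolve_right ?_
      exact_mod_cast hM s ⟨s.val - 1, hj⟩ (by simp only; omega)
    · intro t _ hts
      rw [strictLower_apply]
      split_ifs with hlt
      · have h1 : s.val - 1 < t.val := hlt
        have h2 : s.val ≠ t.val := fun h => hts (Fin.ext h.symm)
        rw [ih t (Fin.lt_def.mpr (by omega)) (by omega), zero_mul]
      · rw [mul_zero]
    · exact fun h => absurd (Finset.mem_univ s) h

/-- Multiplying by powers of `X` further apart than the degrees separates the polynomials `G l`,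
and the irrational factor `β` prevents the coefficients from being rational. -/
theorem eq_zero_of_forall_not_irrational_coeff {d D : ℕ} (G : Fin d → ℚ[X])
    (hG : ∀ l, (G l).natDegree < D) (H : ℝ[X]) (hH : H.natDegree < D) {β : ℝ} (hβ : Irrational β)
    (hrat : ∀ m, ¬ Irrational
      ((∑ l, (G l).map (algebraMap ℚ ℝ) * (C β * X ^ (D * (l.val + 1))) + H).coeff m))
    (l : Fin d) : G l = 0 := by
  ext t
  rw [coeff_zero]
  rcases Nat.lt_or_ge t D with ht | ht
  · by_contra hne
    apply hrat (D * (l.val + 1) + t)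
    have hHc : H.coeff (D * (l.val + 1) + t) = 0 :=
      coeff_eq_zero_of_natDegree_lt (by rw [mul_add]; omega)
    have hterm : ∀ j : Fin d, ((G j).map (algebraMap ℚ ℝ) * (C β * X ^ (D * (j.val + 1)))).coeff
        (D * (l.val + 1) + t) = if j = l then ((G l).coeff t : ℝ) * β else 0 := by
      intro j
      rw [← mul_assoc, coeff_mul_X_pow', coeff_mul_C, coeff_map]
      rcases lt_trichotomy j.val l.val with hlt | heq | hgt
      · have h1 : D * (j.val + 1) + D ≤ D * (l.val + 1) := by
          rw [← Nat.mul_succ]; exact Nat.mul_le_mul_left D (by omega)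
        rw [if_pos (by omega), if_neg (fun h => by subst h; omega),
          coeff_eq_zero_of_natDegree_lt (by have := hG j; omega)]
        simp
      · obtain rfl : j = l := Fin.ext heq
        simp
      · have h1 : D * (l.val + 1) + D ≤ D * (j.val + 1) := by
          rw [← Nat.mul_succ]; exact Nat.mul_le_mul_left D (by omega)
        rw [if_neg (by omega), if_neg (fun h => by subst h; omega)]
    rw [coeff_add, hHc, add_zero, finsetSum_coeff]
    simp only [hterm]
    rw [Finset.sum_ite_eq' Finset.univ l, if_pos (Finset.mem_univ l)]
    exact hβ.ratCast_mul hne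
  · exact coeff_eq_zero_of_natDegree_lt ((hG l).trans_le ht)

/-- A bound for the degrees of the polynomials in `charRow M F u` that does not depend on `u`. -/
noncomputable def charRowDegree {K : ℕ} (d : ℕ) (F : Fin K → ℤ[X]) : ℕ :=
  ∑ i, ∑ k ∈ Finset.range d, ((binomPoly (k + 1)).comp ((F i).map (Int.castRingHom ℚ))).natDegree

open Matrix in
theorem C_vecMul_strictLower_pow {d : ℕ} (M : Matrix (Fin d) (Fin d) ℤ) (v : Fin d → ℤ) (k : ℕ)
    (l : Fin d) : ((fun l => C (v l : ℚ)) ᵥ* strictLower ℚ[X] M ^ k) l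
      = C (((v ᵥ* strictLower ℤ M ^ k) l : ℤ) : ℚ) := by
  have h : strictLower ℚ[X] M ^ k = (strictLower ℤ M ^ k).map (C.comp (Int.castRingHom ℚ)) := by
    rw [Matrix.map_pow, strictLower_map]
  rw [h]
  exact (RingHom.map_vecMul (C.comp (Int.castRingHom ℚ)) (strictLower ℤ M ^ k) v l).symm

open Matrix in
theorem charRow_apply {d K : ℕ} (M : Matrix (Fin d) (Fin d) ℤ) (F : Fin K → ℤ[X])
    (u : Fin K → Fin d → ℤ) (l : Fin d) : charRow M F u l =
      ∑ i, ∑ k ∈ Finset.range d, (binomPoly (k + 1)).comp ((F i).map (Int.castRingHom ℚ)) *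
        C (((u i ᵥ* strictLower ℤ M ^ k) l : ℤ) : ℚ) := by
  simp only [charRow, Finset.sum_apply, Pi.smul_apply, smul_eq_mul, C_vecMul_strictLower_pow]

theorem natDegree_charRow_le {d K : ℕ} (M : Matrix (Fin d) (Fin d) ℤ) (F : Fin K → ℤ[X])
    (u : Fin K → Fin d → ℤ) (l : Fin d) : (charRow M F u l).natDegree ≤ charRowDegree d F := by
  rw [charRow_apply]
  refine natDegree_sum_le_of_forall_le _ _ fun i _ => natDegree_sum_le_of_forall_le _ _ fun k hk => ?_
  refine (natDegree_mul_C_le _ _).trans ?_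
  calc _ ≤ ∑ k ∈ Finset.range d,
        ((binomPoly (k + 1)).comp ((F i).map (Int.castRingHom ℚ))).natDegree :=
        Finset.single_le_sum (f := fun k =>
          ((binomPoly (k + 1)).comp ((F i).map (Int.castRingHom ℚ))).natDegree)
          (fun _ _ => Nat.zero_le _) hk
    _ ≤ _ := Finset.single_le_sum (f := fun i => ∑ k ∈ Finset.range d,
          ((binomPoly (k + 1)).comp ((F i).map (Int.castRingHom ℚ))).natDegree)
          (fun _ _ => Nat.zero_le _) (Finset.mem_univ i)

theorem eval_zero_comp_map {F : ℤ[X]} (hF : F.eval 0 = 0) (k : ℕ) :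
    ((binomPoly (k + 1)).comp (F.map (Int.castRingHom ℚ))).eval 0 = 0 := by
  have : eval (0 : ℚ) (F.map (Int.castRingHom ℚ)) = 0 := by
    simp [← coeff_zero_eq_eval_zero, coeff_map] at hF ⊢
    exact hF
  rw [eval_comp, this, binomPoly_eval_zero]

theorem eval_zero_charRow {d K : ℕ} (M : Matrix (Fin d) (Fin d) ℤ) (F : Fin K → ℤ[X])
    (hF : ∀ i, (F i).eval 0 = 0) (u : Fin K → Fin d → ℤ) (l : Fin d) :
    (charRow M F u l).eval 0 = 0 := by
  rw [charRow_apply, eval_finsetSum]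
  refine Finset.sum_eq_zero fun i _ => ?_
  rw [eval_finsetSum]
  refine Finset.sum_eq_zero fun k _ => ?_
  rw [eval_mul, eval_zero_comp_map (hF i), zero_mul]

open Matrix in
/-- The polynomial orbit `n ↦ (T ^ (F i (n)) x(n))_i` of the real lift of a Weyl system, along the
starting points `x_l(n) = β n ^ (D (l + 1))`. -/
noncomputable def orbitPoly {d K : ℕ} (α : Fin d → ℝ) (M : Matrix (Fin d) (Fin d) ℤ)
    (F : Fin K → ℤ[X]) (β : ℝ) (D : ℕ) (i : Fin K) : Fin d → ℝ[X] :=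
  unipotentOrbit M (fun l => C (α l))
    (fun k => ((binomPoly (k + 1)).comp ((F i).map (Int.castRingHom ℚ))).map (algebraMap ℚ ℝ))
    (fun l => C β * X ^ (D * (l.val + 1)))

theorem eval_orbitPoly {d K : ℕ} (α : Fin d → ℝ) (M : Matrix (Fin d) (Fin d) ℤ)
    (F : Fin K → ℤ[X]) (β : ℝ) (D : ℕ) (i : Fin K) (l : Fin d) (n : ℕ) :
    (orbitPoly α M F β D i l).eval (n : ℝ) = unipotentOrbit M α
      (fun k => (((binomPoly (k + 1)).eval (((F i).eval (n : ℤ) : ℤ) : ℚ) : ℚ) : ℝ))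
      (fun l => β * (n : ℝ) ^ (D * (l.val + 1))) l := by
  rw [orbitPoly, ← coe_evalRingHom, map_unipotentOrbit]
  simp only [coe_evalRingHom, eval_C, eval_mul, eval_pow, eval_X]
  congr 1
  funext k
  have h1 : (n : ℝ) = algebraMap ℚ ℝ (n : ℚ) := by simp
  rw [h1, eval_map_apply, eval_comp]
  have h2 := eval_intCast_map (Int.castRingHom ℚ) (F i) n
  rw [Int.cast_natCast] at h2
  rw [h2]
  rfl

theorem coeff_zero_orbitPoly {d K : ℕ} (α : Fin d → ℝ) (M : Matrix (Fin d) (Fin d) ℤ)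
    (F : Fin K → ℤ[X]) (hF : ∀ i, (F i).eval 0 = 0) (β : ℝ) {D : ℕ} (hD : 0 < D) (i : Fin K)
    (l : Fin d) : (orbitPoly α M F β D i l).coeff 0 = 0 := by
  have h := eval_orbitPoly α M F β D i l 0
  rw [coeff_zero_eq_eval_zero]
  simp only [Nat.cast_zero, hF, Int.cast_zero, binomPoly_eval_zero, Rat.cast_zero] at h
  rw [h]
  have : D * (l.val + 1) ≠ 0 := by positivity
  simp [unipotentOrbit, this]

open Matrix in
/-- A character along which the orbit polynomials are rational annihilates them identically, as
polynomials in `n` and in the starting point. -/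
theorem charRow_eq_zero {d K : ℕ} (α : Fin d → ℝ) (M : Matrix (Fin d) (Fin d) ℤ)
    (hS : IsQuasiStandard α M) (F : Fin K → ℤ[X]) (hF : ∀ i, (F i).eval 0 = 0) {β : ℝ}
    (hβ : Irrational β) (u : Fin K → Fin d → ℤ)
    (hrat : ∀ m, ¬ Irrational (∑ i, ∑ l, u i l *
      (orbitPoly α M F β (charRowDegree d F + 1) i l).coeff m)) :
    (∀ l, ∑ i, u i l = 0) ∧ charRow M F u = 0 := by
  generalize hD : charRowDegree d F + 1 = D at hrat
  let φ : ℚ[X] →+* ℝ[X] := mapRingHom (algebraMap ℚ ℝ)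
  let xs : Fin d → ℝ[X] := fun l => C β * X ^ (D * (l.val + 1))
  let αs : Fin d → ℝ[X] := fun l => C (α l)
  let R : Fin d → ℚ[X] := charRow M F u
  let G : Fin d → ℚ[X] := fun l => C ((∑ i, u i l : ℤ) : ℚ) + (R ᵥ* strictLower ℚ[X] M) l
  let H : ℝ[X] := ∑ l, φ (R l) * C (α l)
  have hRdeg : ∀ l, (R l).natDegree < D := fun l => by
    have := natDegree_charRow_le M F u l
    simp only [R]
    omega
  have hGdeg : ∀ l, (G l).natDegree < D := by
    intro l
    simp only [G, vecMul, dotProduct]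
    refine lt_of_le_of_lt (natDegree_add_le _ _) (max_lt (by rw [natDegree_C]; omega) ?_)
    rw [← hD]
    refine Nat.lt_succ_of_le (natDegree_sum_le_of_forall_le _ _ fun s _ => ?_)
    rw [strictLower_apply]
    split_ifs
    · rw [← C_eq_intCast]
      exact (natDegree_mul_C_le _ _).trans (natDegree_charRow_le M F u s)
    · simp
  have hHdeg : H.natDegree < D := by
    simp only [H]
    rw [← hD]
    refine Nat.lt_succ_of_le (natDegree_sum_le_of_forall_le _ _ fun s _ => ?_)
    exact (natDegree_mul_C_le _ _).trans (natDegree_map_le.trans (natDegree_charRow_le M F u s))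
  have hφR : ∀ l, φ (R l) = (∑ i, ∑ k ∈ Finset.range d,
      ((binomPoly (k + 1)).comp ((F i).map (Int.castRingHom ℚ))).map (algebraMap ℚ ℝ) •
        ((fun l => C (u i l : ℝ)) ᵥ* strictLower ℝ[X] M ^ k)) l := by
    intro l
    simp only [R, charRow, Finset.sum_apply, Pi.smul_apply, smul_eq_mul, map_sum, map_mul,
      RingHom.map_vecMul, Matrix.map_pow, strictLower_map]
    have hC : ∀ i, (φ ∘ fun l => C (u i l : ℚ)) = fun l => C (u i l : ℝ) := by
      intro i
      funext l
      simp [φ]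
    simp only [hC]
    rfl
  have hsum : ∑ i, ∑ l, C (u i l : ℝ) * orbitPoly α M F β D i l
      = ∑ l, (G l).map (algebraMap ℚ ℝ) * (C β * X ^ (D * (l.val + 1))) + H := by
    have h1 : ∀ i, ∑ l, C (u i l : ℝ) * orbitPoly α M F β D i l
        = (fun l => C (u i l : ℝ)) ⬝ᵥ xs + (∑ k ∈ Finset.range d,
          ((binomPoly (k + 1)).comp ((F i).map (Int.castRingHom ℚ))).map (algebraMap ℚ ℝ) •
          ((fun l => C (u i l : ℝ)) ᵥ* strictLower ℝ[X] M ^ k)) ⬝ᵥ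
          (strictLower ℝ[X] M *ᵥ xs + αs) := fun i => dotProduct_unipotentOrbit M αs _ xs _
    have hR' : (fun l => φ (R l)) = ∑ i, ∑ k ∈ Finset.range d,
      ((binomPoly (k + 1)).comp ((F i).map (Int.castRingHom ℚ))).map (algebraMap ℚ ℝ) •
        ((fun l => C (u i l : ℝ)) ᵥ* strictLower ℝ[X] M ^ k) := funext hφR
    rw [Finset.sum_congr rfl fun i _ => h1 i, Finset.sum_add_distrib, ← sum_dotProduct,
      ← sum_dotProduct, ← hR', dotProduct_add, dotProduct_mulVec, ← add_assoc, ← add_dotProduct]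
    congr 1
    refine Finset.sum_congr rfl fun l _ => ?_
    congr 1
    simp only [G, Polynomial.map_add, Pi.add_apply, Finset.sum_apply]
    congr 1
    · simp [Polynomial.map_sum]
    · have := RingHom.map_vecMul φ (strictLower ℚ[X] M) R l
      rw [strictLower_map] at this
      exact this.symm
  have hrat' : ∀ m, ¬ Irrational
      ((∑ l, (G l).map (algebraMap ℚ ℝ) * (C β * X ^ (D * (l.val + 1))) + H).coeff m) := by
    intro m
    rw [← hsum]
    simpa only [finsetSum_coeff, coeff_C_mul] using hrat m
  have hG0 := eq_zero_of_forall_not_irrational_coeff G hGdeg H hHdeg hβ hrat'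
  have hS0 : ∀ l, ∑ i, u i l = 0 := by
    intro l
    have h := congrArg (eval 0) (hG0 l)
    have hz : eval 0 ((R ᵥ* strictLower ℚ[X] M) l) = 0 := by
      rw [vecMul, dotProduct, eval_finsetSum]
      refine Finset.sum_eq_zero fun s _ => ?_
      rw [eval_mul, eval_zero_charRow M F hF, zero_mul]
    simp only [G, eval_add, eval_C, hz, eval_zero, add_zero] at h
    exact_mod_cast h
  have hRN : R ᵥ* strictLower ℚ[X] M = 0 := by
    funext l
    have h := hG0 l
    simp only [G, hS0, Int.cast_zero, C_0, zero_add] at h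
    exact h
  have hRs := eq_zero_of_vecMul_strictLower_eq_zero M hS.2 R hRN
  refine ⟨hS0, funext fun s => ?_⟩
  rcases Nat.eq_zero_or_pos s.val with hs | hs
  · have hH : H = φ (R s) * C (α s) := by
      refine Finset.sum_eq_single s (fun t _ hts => ?_) (fun h => absurd (Finset.mem_univ s) h)
      rw [hRs t (Nat.pos_of_ne_zero fun h => hts (Fin.ext (h.trans hs.symm))), map_zero, zero_mul]
    ext m
    by_contra hne
    apply hrat' m
    simp only [hG0, Polynomial.map_zero, zero_mul, Finset.sum_const_zero, zero_add]
    rw [hH, coeff_mul_C]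
    simp only [φ, coe_mapRingHom, coeff_map]
    exact (hS.1 s hs).ratCast_mul hne
  · exact hRs s hs

/-- The inclusion defining the Weyl complexity holds as soon as the characters that annihilate the
orbit identically do not involve the coordinates of index at least `r`. -/
theorem weylProperty_of_charRow {k : ℕ} (f : Fin k → ℤ[X]) (hf : ∀ i, (f i).eval 0 = 0) (r : ℕ)
    (h : ∀ d : ℕ, r ≤ d → ∀ (α : Fin d → ℝ) (M : Matrix (Fin d) (Fin d) ℤ), IsQuasiStandard α M →
      ∀ u : Fin (k + 1) → Fin d → ℤ, (∀ l, ∑ i, u i l = 0) →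
        charRow M (Fin.cons 0 f : Fin (k + 1) → ℤ[X]) u = 0 →
        ∀ i l, r ≤ l.val + 1 → u i l = 0) : WeylProperty f r := by
  intro d hd α M hS y hy
  set F : Fin (k + 1) → ℤ[X] := Fin.cons 0 f with hFdef
  have hF : ∀ i, (F i).eval 0 = 0 := by
    intro i
    refine Fin.cases ?_ (fun j => ?_) i
    · simp [hFdef]
    · simpa [hFdef] using hf j
  have hrep : ∀ t : UnitAddCircle, ∃ x : ℝ, (x : UnitAddCircle) = t ∧ (t = 0 → x = 0) := by
    intro t
    by_cases ht : t = 0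
    · exact ⟨0, by simp [ht], fun _ => rfl⟩
    · obtain ⟨x, hx⟩ := QuotientAddGroup.mk_surjective t
      exact ⟨x, hx, fun h => absurd h ht⟩
  choose rep hrep1 hrep2 using hrep
  rw [Metric.mem_closure_iff]
  intro ε hε
  let D := charRowDegree d F + 1
  obtain ⟨n, hn, hnlt⟩ := exists_norm_eval_sub_lt
    (fun p : Fin (k + 1) × Fin d => orbitPoly α M F (√2) D p.1 p.2)
    (fun p => coeff_zero_orbitPoly α M F hF _ (Nat.succ_pos _) p.1 p.2)
    (fun p => rep (y p.1 p.2)) (fun u hu => by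
      simp only [Fintype.sum_prod_type] at hu ⊢
      obtain ⟨h1, h2⟩ := charRow_eq_zero α M hS F hF irrational_sqrt_two (fun i l => u (i, l)) hu
      refine ⟨0, ?_⟩
      rw [Int.cast_zero]
      refine Finset.sum_eq_zero fun i _ => Finset.sum_eq_zero fun l _ => ?_
      rcases Nat.lt_or_ge (l.val + 1) r with hl | hl
      · rw [hrep2 _ (hy i l hl), mul_zero]
      · have := h d hd α M hS (fun i l => u (i, l)) h1 h2 i l hl
        rw [this, Int.cast_zero, zero_mul]) hε
  let x : Fin d → ℝ := fun l => √2 * (n : ℝ) ^ (D * (l.val + 1))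
  refine ⟨fun i l => ((orbitPoly α M F (√2) D i l).eval (n : ℝ) : ℝ), ?_, ?_⟩
  · refine ⟨fun l => (x l : UnitAddCircle), n, hn, ?_⟩
    have hpt : ∀ i, (fun l => (((orbitPoly α M F (√2) D i l).eval (n : ℝ) : ℝ) : UnitAddCircle))
        = (weylEquiv α M ^ ((F i).eval (n : ℤ))) (fun l => (x l : UnitAddCircle)) := by
      intro i
      rw [weylEquiv_zpow_coe]
      funext l
      rw [eval_orbitPoly]
    funext i
    rw [hpt]
    refine Fin.cases ?_ (fun j => ?_) i
    · simp [hFdef]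
    · simp [hFdef]
  · rw [dist_pi_lt_iff hε]
    intro i
    rw [dist_pi_lt_iff hε]
    intro l
    have := hnlt (i, l)
    rw [dist_comm, dist_eq_norm]
    rwa [AddCircle.coe_sub, hrep1] at this

/-! ### Quadratic relations between three polynomials -/

/-- The coefficients `c` and `w` give a linear relation `∑ c_i f_i = 0` between the polynomials and
an expression of `∑ c_i f_i ^ 2` as a linear combination of them. -/
def QuadraticRelation (f : Fin 3 → ℤ[X]) (c w : Fin 3 → ℤ) : Prop :=
  ∑ i, C (c i) * f i = 0 ∧ ∑ i, (C (w i) * f i + C (c i) * f i ^ 2) = 0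

theorem QuadraticRelation.comp_perm {f : Fin 3 → ℤ[X]} {c w : Fin 3 → ℤ}
    (h : QuadraticRelation f c w) (σ : Equiv.Perm (Fin 3)) :
    QuadraticRelation (fun i => f (σ i)) (fun i => c (σ i)) (fun i => w (σ i)) :=
  ⟨(Equiv.sum_comp σ fun i => C (c i) * f i).trans h.1,
    (Equiv.sum_comp σ fun i => C (w i) * f i + C (c i) * f i ^ 2).trans h.2⟩

theorem HasSpecialForm.of_comp_perm {f : Fin 3 → ℤ[X]} (σ : Equiv.Perm (Fin 3))
    (h : HasSpecialForm fun i => f (σ i)) : HasSpecialForm f := by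
  obtain ⟨τ, hτ⟩ := h
  exact ⟨σ * τ, hτ⟩

/-- A nonconstant polynomial is transcendental over the constants, in the degrees needed. -/
theorem coeff_eq_zero_of_sum_pow_eq_zero {q : ℤ[X]} (hq : 0 < q.natDegree) {a₁ a₂ a₃ a₄ a₅ a₆ : ℤ}
    (h : C a₁ * q + C a₂ * q ^ 2 + C a₃ * q ^ 3 + C a₄ * q ^ 4 + C a₅ * q ^ 5 + C a₆ * q ^ 6 = 0) :
    a₁ = 0 ∧ a₂ = 0 ∧ a₃ = 0 ∧ a₄ = 0 ∧ a₅ = 0 ∧ a₆ = 0 := by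
  let G : ℤ[X] := C a₁ * X + C a₂ * X ^ 2 + C a₃ * X ^ 3 + C a₄ * X ^ 4 + C a₅ * X ^ 5 + C a₆ * X ^ 6
  have hG : G.comp q = 0 := by simpa [G] using h
  have hG0 : G = 0 := by
    rcases comp_eq_zero_iff.mp hG with h | ⟨-, h⟩
    · exact h
    · rw [h, natDegree_C] at hq
      exact absurd hq (lt_irrefl _)
  have hc : ∀ n, G.coeff n = 0 := fun n => by rw [hG0, coeff_zero]
  have h1 := hc 1
  have h2 := hc 2
  have h3 := hc 3
  have h4 := hc 4
  have h5 := hc 5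
  have h6 := hc 6
  simp only [G, coeff_add, coeff_C_mul, coeff_X, coeff_X_pow] at h1 h2 h3 h4 h5 h6
  norm_num at h1 h2 h3 h4 h5 h6
  exact ⟨h1, h2, h3, h4, h5, h6⟩

/-- A consequence of the lemma of Gauss. -/
theorem dvd_of_dvd_C_mul {p g : ℤ[X]} (hp : p.IsPrimitive) {a : ℤ} (ha : a ≠ 0)
    (h : p ∣ C a * g) : p ∣ g := by
  rw [IsPrimitive.Int.dvd_iff_map_cast_dvd_map_cast _ _ hp]
  have h1 := map_dvd (mapRingHom (Int.castRingHom ℚ)) h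
  rw [map_mul] at h1
  refine (IsUnit.dvd_mul_left ?_).mp h1
  rw [coe_mapRingHom, map_C]
  exact isUnit_C.mpr (isUnit_iff_ne_zero.mpr (by simpa using ha))

theorem exists_eq_C_mul_of_C_mul_eq {p g : ℤ[X]} (hp : p.IsPrimitive) {a b : ℤ} (ha : a ≠ 0)
    (h : C a * g = C b * p) : ∃ m : ℤ, g = C m * p := by
  obtain ⟨k, hk⟩ := dvd_of_dvd_C_mul hp ha (Dvd.intro_left _ h.symm)
  have hp0 : p ≠ 0 := hp.ne_zero
  have h1 : C a * k = C b := by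
    apply mul_left_cancel₀ hp0
    rw [hk] at h
    linear_combination h
  have h2 : k.natDegree = 0 := by
    have := congrArg natDegree h1
    rwa [natDegree_C_mul ha, natDegree_C] at this
  rw [eq_C_of_natDegree_eq_zero h2] at hk
  exact ⟨_, by rw [hk]; ring⟩

/-- If a multiple of `g` is a combination of `p` and `p ^ 2`, with `p` primitive and `p(0) = 0`, so
is `g` itself. -/
theorem exists_eq_quadratic {p g : ℤ[X]} (hp : p.IsPrimitive) (hp0 : p.coeff 0 = 0) {D A B : ℤ}
    (hD : D ≠ 0) (h : C D * g = C A * p + C B * p ^ 2) :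
    ∃ k r : ℤ, g = C k * p ^ 2 + C r * p := by
  obtain ⟨g', hg'⟩ := dvd_of_dvd_C_mul hp hD (g := g) ⟨C A + C B * p, by rw [h]; ring⟩
  have h1 : C D * g' = C A + C B * p := by
    apply mul_left_cancel₀ hp.ne_zero
    rw [hg'] at h
    linear_combination h
  have h2 : D * g'.coeff 0 = A := by
    have := congrArg (fun f => coeff f 0) h1
    simpa [hp0, coeff_C_mul] using this
  obtain ⟨k, hk⟩ := exists_eq_C_mul_of_C_mul_eq (g := g' - C (g'.coeff 0)) (b := B) hp hD (by
    rw [mul_sub, h1, ← C_mul, h2]; ring)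
  exact ⟨k, g'.coeff 0, by rw [hg']; linear_combination p * hk⟩

theorem exists_isPrimitive_eq_C_mul {f : ℤ[X]} (hf : 0 < f.natDegree) (h0 : f.coeff 0 = 0) :
    ∃ (p : ℤ[X]) (l : ℤ), p.IsPrimitive ∧ l ≠ 0 ∧ f = C l * p ∧ 0 < p.natDegree ∧ p.coeff 0 = 0 := by
  have hne : f ≠ 0 := by rintro rfl; simp at hf
  have hc : f.content ≠ 0 := by rwa [Ne, content_eq_zero_iff]
  refine ⟨f.primPart, f.content, f.isPrimitive_primPart, hc, f.eq_C_content_mul_primPart,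
    by rwa [natDegree_primPart], ?_⟩
  have := congrArg (fun f => coeff f 0) f.eq_C_content_mul_primPart
  simp only [h0, coeff_C_mul] at this
  exact (mul_eq_zero.mp this.symm).resolve_left hc

section
variable {f : Fin 3 → ℤ[X]}


/-- If one coefficient of the linear relation vanishes, two of the polynomials are proportional to
some `p`, and the quadratic relation expresses the third one through `p` and `p ^ 2`. -/
theorem formA_of_quadraticRelation (h0 : ∀ i, (f i).coeff 0 = 0) (hpos : ∀ i, 0 < (f i).natDegree)
    (hinj : Function.Injective f) {c w : Fin 3 → ℤ} (hc : c ≠ 0) (h : QuadraticRelation f c w)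
    (h2 : c 2 = 0) : FormA f := by
  obtain ⟨e1, e2⟩ := h
  simp only [Fin.sum_univ_three, h2, C_0, zero_mul, add_zero] at e1 e2
  have hne : ∀ i, f i ≠ 0 := fun i hi => by simpa [hi] using hpos i
  have hc1 : c 1 ≠ 0 := by
    intro h1
    rw [h1, C_0, zero_mul, add_zero] at e1
    have hc0 : c 0 = 0 := C_eq_zero.mp ((mul_eq_zero.mp e1).resolve_right (hne 0))
    exact hc (by ext i; fin_cases i <;> simp [hc0, h1, h2])
  obtain ⟨p, l, hp, hl, hf0, hpdeg, hp0⟩ := exists_isPrimitive_eq_C_mul (hpos 0) (h0 0)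
  obtain ⟨m, hf1⟩ := exists_eq_C_mul_of_C_mul_eq (g := f 1) (b := -(c 0 * l)) hp hc1 (by
    rw [hf0] at e1; simp only [C_neg, C_mul]; linear_combination e1)
  have hlm : l ≠ m := by
    rintro rfl
    exact absurd (hinj (hf0.trans hf1.symm)) (by decide)
  rw [hf0, hf1] at e1 e2
  have hlin : c 0 * l + c 1 * m = 0 := by
    have : C (c 0 * l + c 1 * m) * p = 0 := by
      simp only [C_add, C_mul]; linear_combination e1
    exact C_eq_zero.mp ((mul_eq_zero.mp this).resolve_right hp.ne_zero)
  have hm : m ≠ 0 := by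
    rintro rfl
    exact hne 1 (by rw [hf1]; simp)
  have hw2 : w 2 ≠ 0 := by
    intro hw
    have := coeff_eq_zero_of_sum_pow_eq_zero hpdeg (a₁ := w 0 * l + w 1 * m)
      (a₂ := c 0 * l ^ 2 + c 1 * m ^ 2) (a₃ := 0) (a₄ := 0) (a₅ := 0) (a₆ := 0) (by
        rw [hw] at e2
        simp only [C_add, C_mul, C_pow, C_0] at e2 ⊢
        linear_combination e2)
    have hq := this.2.1
    have : c 1 * (m * (m - l)) = 0 := by linear_combination hq - l * hlin
    have h3 := mul_ne_zero hc1 (mul_ne_zero hm (sub_ne_zero.mpr hlm.symm))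
    exact h3 this
  obtain ⟨k, r, hf2⟩ := exists_eq_quadratic (g := f 2) (A := -(w 0 * l + w 1 * m))
    (B := -(c 0 * l ^ 2 + c 1 * m ^ 2)) hp hp0 hw2 (by
      simp only [C_add, C_mul, C_pow, C_neg]
      linear_combination e2)
  exact ⟨p, k, l, m, r, hf0, hf1, hf2⟩

/-- If the coefficients of the linear relation have sum zero and none vanishes, the differences of
the polynomials are proportional to some `p`, the quadratic relation involves the polynomials
themselves only linearly, and expresses them through `p` and `p ^ 2`. -/
theorem formB_of_quadraticRelation (h0 : ∀ i, (f i).coeff 0 = 0)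
    (hinj : Function.Injective f) {c w : Fin 3 → ℤ} (hc : ∀ i, c i ≠ 0)
    (h : QuadraticRelation f c w) (hs : c 0 + c 1 + c 2 = 0) : FormB f := by
  obtain ⟨e1, e2⟩ := h
  simp only [Fin.sum_univ_three] at e1 e2
  have hC2 : (C (c 2) : ℤ[X]) = -(C (c 0) + C (c 1)) := by
    rw [← C_add, ← C_neg]; congr 1; linarith
  rw [hC2] at e1 e2
  have hd0 : (f 0 - f 2).coeff 0 = 0 := by rw [coeff_sub, h0, h0, sub_zero]
  have hdpos : 0 < (f 0 - f 2).natDegree := by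
    rw [Nat.pos_iff_ne_zero]
    intro hz
    have := eq_C_of_natDegree_eq_zero hz
    rw [hd0, C_0, sub_eq_zero] at this
    exact absurd (hinj this) (by decide)
  obtain ⟨p, a, hp, ha, hfa, hpdeg, hp0⟩ := exists_isPrimitive_eq_C_mul hdpos hd0
  obtain ⟨b, hfb⟩ := exists_eq_C_mul_of_C_mul_eq (g := f 1 - f 2) (b := -(c 0 * a)) hp (hc 1) (by
    simp only [C_neg, C_mul]; linear_combination e1 - C (c 0) * hfa)
  have hf0 : f 0 = f 2 + C a * p := by linear_combination hfa
  have hf1 : f 1 = f 2 + C b * p := by linear_combination hfb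
  have hab : a ≠ b := by
    rintro rfl
    exact absurd (hinj (hf0.trans hf1.symm)) (by decide)
  have hlin : c 0 * a + c 1 * b = 0 := by
    have : C (c 0 * a + c 1 * b) * p = 0 := by
      simp only [C_add, C_mul]; rw [hf0, hf1] at e1; linear_combination e1
    exact C_eq_zero.mp ((mul_eq_zero.mp this).resolve_right hp.ne_zero)
  have hlin' : (C (c 0) * C a + C (c 1) * C b : ℤ[X]) = 0 := by
    rw [← C_mul, ← C_mul, ← C_add, hlin, C_0]
  rw [hf0, hf1] at e2
  have hrel : C (w 0 + w 1 + w 2) * f 2 =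
      C (-(w 0 * a + w 1 * b)) * p + C (-(c 0 * a ^ 2 + c 1 * b ^ 2)) * p ^ 2 := by
    simp only [C_add, C_mul, C_pow, C_neg]
    linear_combination e2 - 2 * f 2 * p * hlin'
  have hw : w 0 + w 1 + w 2 ≠ 0 := by
    intro hw
    have := coeff_eq_zero_of_sum_pow_eq_zero hpdeg (a₁ := -(w 0 * a + w 1 * b))
      (a₂ := -(c 0 * a ^ 2 + c 1 * b ^ 2)) (a₃ := 0) (a₄ := 0) (a₅ := 0) (a₆ := 0) (by
        rw [hw] at hrel
        simp only [C_0] at hrel ⊢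
        linear_combination -hrel)
    have hq := this.2.1
    have : c 0 * (a * (a - b)) = 0 := by linear_combination -hq - b * hlin
    exact mul_ne_zero (hc 0) (mul_ne_zero ha (sub_ne_zero.mpr hab)) this
  obtain ⟨k, r, hf2⟩ := exists_eq_quadratic hp hp0 hw hrel
  refine ⟨p, k, r + a, r + b, r, ?_, ?_, hf2⟩
  · rw [hf0, hf2, C_add]; ring
  · rw [hf1, hf2, C_add]; ring

/-- If no coefficient of the linear relation vanishes and their sum is not zero, the three
polynomials are proportional: otherwise the quadratic form `∑ c_i x_i ^ 2` would be nondegenerate on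
the plane they span, while comparison of the two highest degrees occurring there shows that the
degree of its value is too large. -/
theorem formA_of_quadraticRelation_of_sum_ne_zero (h0 : ∀ i, (f i).coeff 0 = 0)
    (hpos : ∀ i, 0 < (f i).natDegree) {c w : Fin 3 → ℤ} (hc : ∀ i, c i ≠ 0)
    (h : QuadraticRelation f c w) (hs : c 0 + c 1 + c 2 ≠ 0)
    (hmax : ∀ i, (f i).natDegree ≤ (f 0).natDegree) : FormA f := by
  obtain ⟨e1, e2⟩ := h
  simp only [Fin.sum_univ_three] at e1 e2
  set D := (f 0).natDegree with hD
  have hDpos : 0 < D := hpos 0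
  have hne : ∀ i, f i ≠ 0 := fun i hi => by simpa [hi] using hpos i
  set a : Fin 3 → ℤ := fun i => (f i).coeff D with ha
  have ha0 : a 0 ≠ 0 := by
    simp only [ha, hD, coeff_natDegree]; exact leadingCoeff_ne_zero.mpr (hne 0)
  have hfa : ∀ i, (f i).coeff D = a i := fun _ => rfl
  -- the coefficients of the two relations at `X ^ D` and `X ^ (2 D)`
  have l1 : c 0 * a 0 + c 1 * a 1 + c 2 * a 2 = 0 := by
    have := congrArg (fun g => coeff g D) e1
    simpa only [coeff_add, coeff_C_mul, coeff_zero, hfa] using this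
  have hbig : ∀ (i : Fin 3) (n : ℕ), D < n → (f i).coeff n = 0 := fun i n hn =>
    coeff_eq_zero_of_natDegree_lt ((hmax i).trans_lt hn)
  have l2 : c 0 * a 0 ^ 2 + c 1 * a 1 ^ 2 + c 2 * a 2 ^ 2 = 0 := by
    have hsq : ∀ i, (f i ^ 2).coeff (2 * D) = a i ^ 2 := fun i =>
      coeff_pow_of_natDegree_le (hmax i)
    have := congrArg (fun g => coeff g (2 * D)) e2
    simpa only [coeff_add, coeff_C_mul, coeff_zero, hsq, hbig _ (2 * D) (by omega), mul_zero,
      zero_add] using this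
  set h1 : ℤ[X] := C (a 0) * f 1 - C (a 1) * f 0 with hh1
  set h2 : ℤ[X] := C (a 0) * f 2 - C (a 2) * f 0 with hh2
  have l1' : (C (c 0) * C (a 0) + C (c 1) * C (a 1) + C (c 2) * C (a 2) : ℤ[X]) = 0 := by
    simp only [← C_mul, ← C_add, l1, C_0]
  have l2' : (C (c 0) * C (a 0) ^ 2 + C (c 1) * C (a 1) ^ 2 + C (c 2) * C (a 2) ^ 2 : ℤ[X]) = 0 := by
    simp only [← C_mul, ← C_add, ← C_pow, l2, C_0]
  have hlin : C (c 1) * h1 + C (c 2) * h2 = 0 := by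
    rw [hh1, hh2]
    linear_combination C (a 0) * e1 - f 0 * l1'
  have hh1zero : h1 = 0 := by
    by_contra hne1
    set E := h1.natDegree with hE
    have hle : E ≤ D := by
      rw [hE, hh1]
      exact (natDegree_sub_le _ _).trans (max_le ((natDegree_C_mul_le _ _).trans (hmax 1))
        ((natDegree_C_mul_le _ _).trans (hmax 0)))
    have hlt : E < D := by
      refine lt_of_le_of_ne hle fun hED => leadingCoeff_ne_zero.mpr hne1 ?_
      rw [leadingCoeff, ← hE, hED, hh1, coeff_sub, coeff_C_mul, coeff_C_mul, hfa, hfa]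
      ring
    have hEpos : 0 < E := by
      rw [Nat.pos_iff_ne_zero]
      intro hz
      apply hne1
      rw [eq_C_of_natDegree_eq_zero hz, hh1, coeff_sub, coeff_C_mul, coeff_C_mul, h0, h0]
      simp
    have hrel : C (2 * c 2 * c 1 * (a 1 - a 2)) * (f 0 * h1) + C (c 1 * c 2 + c 1 ^ 2) * h1 ^ 2
        = C (-(c 2 * a 0 ^ 2)) * (C (w 0) * f 0 + C (w 1) * f 1 + C (w 2) * f 2) := by
      simp only [C_mul, C_add, C_sub, C_pow, C_neg, C_ofNat]
      have hf1 : C (a 0) * f 1 = h1 + C (a 1) * f 0 := by rw [hh1]; ring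
      have hf2 : C (a 0) * f 2 = h2 + C (a 2) * f 0 := by rw [hh2]; ring
      have q1 : C (a 0) ^ 2 * f 1 ^ 2 = (h1 + C (a 1) * f 0) ^ 2 := by rw [← hf1]; ring
      have q2 : C (a 0) ^ 2 * f 2 ^ 2 = (h2 + C (a 2) * f 0) ^ 2 := by rw [← hf2]; ring
      linear_combination C (c 2) * C (a 0) ^ 2 * e2 - C (c 2) * C (c 1) * q1
        - C (c 2) * C (c 2) * q2 - C (c 2) * f 0 ^ 2 * l2'
        - (2 * C (c 2) * C (a 2) * f 0 + C (c 2) * h2 - C (c 1) * h1) * hlin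
    -- the coefficients of degree `D + E`, which exceeds both `2 E` and `D`
    have hcoef := congrArg (fun g => coeff g (D + E)) hrel
    have k1 : (f 0 * h1).coeff (D + E) = a 0 * h1.leadingCoeff :=
      coeff_mul_add_eq_of_natDegree_le le_rfl le_rfl
    have k2 : (h1 ^ 2).coeff (D + E) = 0 :=
      coeff_eq_zero_of_natDegree_lt (natDegree_pow_le.trans_lt (by omega))
    simp only [coeff_add, coeff_C_mul, k1, k2, hbig _ (D + E) (by omega), mul_zero, add_zero]
      at hcoef
    have ha12 : a 1 - a 2 = 0 := by
      have hl := leadingCoeff_ne_zero.mpr hne1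
      simpa [hc 1, hc 2, ha0, hl] using hcoef
    have ha12' : a 2 = a 1 := by linarith
    rw [ha12'] at l1 l2
    have h3 : c 0 * a 0 * (a 0 - a 1) = 0 := by linear_combination l2 - a 1 * l1
    have h4 : a 0 - a 1 = 0 := by simpa [hc 0, ha0] using h3
    have h5 : a 1 = a 0 := by linarith
    rw [h5] at l1
    have h6 : (c 0 + c 1 + c 2) * a 0 = 0 := by linear_combination l1
    exact mul_ne_zero hs ha0 h6
  have hh2zero : h2 = 0 := by
    rw [hh1zero, mul_zero, zero_add] at hlin
    exact (mul_eq_zero.mp hlin).resolve_left (C_ne_zero.mpr (hc 2))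
  obtain ⟨p, l, hp, hl, hf0, hpdeg, hp0⟩ := exists_isPrimitive_eq_C_mul (hpos 0) (h0 0)
  obtain ⟨m, hf1⟩ := exists_eq_C_mul_of_C_mul_eq (g := f 1) (b := a 1 * l) hp ha0 (by
    rw [C_mul, mul_assoc, ← hf0]; linear_combination hh1zero)
  obtain ⟨r, hf2⟩ := exists_eq_C_mul_of_C_mul_eq (g := f 2) (b := a 2 * l) hp ha0 (by
    rw [C_mul, mul_assoc, ← hf0]; linear_combination hh2zero)
  exact ⟨p, 0, l, m, r, hf0, hf1, by rw [hf2]; simp⟩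

theorem hasSpecialForm_of_quadraticRelation (h0 : ∀ i, (f i).coeff 0 = 0)
    (hpos : ∀ i, 0 < (f i).natDegree) (hinj : Function.Injective f) {c w : Fin 3 → ℤ} (hc : c ≠ 0)
    (h : QuadraticRelation f c w) : HasSpecialForm f := by
  by_cases hz : ∃ i, c i = 0
  · obtain ⟨i, hi⟩ := hz
    let σ : Equiv.Perm (Fin 3) := Equiv.swap i 2
    refine HasSpecialForm.of_comp_perm σ ⟨1, Or.inl ?_⟩
    refine formA_of_quadraticRelation (fun j => h0 _) (fun j => hpos _)
      (hinj.comp σ.injective) (fun hcz => hc ?_) (h.comp_perm σ) ?_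
    · funext j
      simpa using congrFun hcz (σ.symm j)
    · simp [σ, hi]
  · push Not at hz
    by_cases hs : c 0 + c 1 + c 2 = 0
    · exact ⟨1, Or.inr (formB_of_quadraticRelation h0 hinj hz h hs)⟩
    · obtain ⟨i, -, hi⟩ := Finset.exists_max_image Finset.univ (fun i => (f i).natDegree)
        ⟨0, Finset.mem_univ 0⟩
      let σ : Equiv.Perm (Fin 3) := Equiv.swap 0 i
      refine HasSpecialForm.of_comp_perm σ ⟨1, Or.inl ?_⟩
      refine formA_of_quadraticRelation_of_sum_ne_zero (fun j => h0 _) (fun j => hpos _)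
        (fun j => hz _) (h.comp_perm σ) ?_ (fun j => ?_)
      · have := Equiv.sum_comp σ c
        simp only [Fin.sum_univ_three] at this
        rwa [this]
      · simpa [σ] using hi _ (Finset.mem_univ _)

end

/-! ### Quadratic and cubic relations for the special forms -/

theorem eq_zero_of_vandermonde {l c : Fin 3 → ℤ} (hl : Function.Injective l)
    (e0 : c 0 + c 1 + c 2 = 0) (e1 : c 0 * l 0 + c 1 * l 1 + c 2 * l 2 = 0)
    (e2 : c 0 * l 0 ^ 2 + c 1 * l 1 ^ 2 + c 2 * l 2 ^ 2 = 0) : c = 0 := by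
  have h01 : l 0 - l 1 ≠ 0 := sub_ne_zero.mpr (hl.ne (by decide))
  have h02 : l 0 - l 2 ≠ 0 := sub_ne_zero.mpr (hl.ne (by decide))
  have h12 : l 1 - l 2 ≠ 0 := sub_ne_zero.mpr (hl.ne (by decide))
  have k0 : c 0 * ((l 0 - l 1) * (l 0 - l 2)) = 0 := by
    linear_combination e2 - (l 1 + l 2) * e1 + l 1 * l 2 * e0
  have k1 : c 1 * ((l 0 - l 1) * (l 1 - l 2)) = 0 := by
    linear_combination -e2 + (l 0 + l 2) * e1 - l 0 * l 2 * e0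
  have k2 : c 2 * ((l 0 - l 2) * (l 1 - l 2)) = 0 := by
    linear_combination e2 - (l 0 + l 1) * e1 + l 0 * l 1 * e0
  funext i
  fin_cases i
  · exact (mul_eq_zero.mp k0).resolve_right (mul_ne_zero h01 h02)
  · exact (mul_eq_zero.mp k1).resolve_right (mul_ne_zero h01 h12)
  · exact (mul_eq_zero.mp k2).resolve_right (mul_ne_zero h02 h12)

/-- The system of the first three power moments, for nonzero nodes. -/
theorem eq_zero_of_vandermonde' {l c : Fin 3 → ℤ} (hl : Function.Injective l) (hl0 : ∀ i, l i ≠ 0)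
    (e1 : c 0 * l 0 + c 1 * l 1 + c 2 * l 2 = 0)
    (e2 : c 0 * l 0 ^ 2 + c 1 * l 1 ^ 2 + c 2 * l 2 ^ 2 = 0)
    (e3 : c 0 * l 0 ^ 3 + c 1 * l 1 ^ 3 + c 2 * l 2 ^ 3 = 0) : c = 0 := by
  have h := eq_zero_of_vandermonde (c := fun i => c i * l i) hl e1
    (by linear_combination e2) (by linear_combination e3)
  funext i
  exact (mul_eq_zero.mp (congrFun h i)).resolve_right (hl0 i)

section
variable {f : Fin 3 → ℤ[X]}


/-- Distinctness of three polynomials of the first special form, in terms of its parameters. -/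
theorem FormA.parameters_ne (hpos : ∀ i, 0 < (f i).natDegree) (hinj : Function.Injective f) {q : ℤ[X]}
    {k l m r : ℤ} (h0 : f 0 = C l * q) (h1 : f 1 = C m * q) (h2 : f 2 = C k * q ^ 2 + C r * q) :
    0 < q.natDegree ∧ l ≠ 0 ∧ m ≠ 0 ∧ l ≠ m ∧ (k = 0 → r ≠ 0 ∧ l ≠ r ∧ m ≠ r) := by
  have hne : ∀ i, f i ≠ 0 := fun i hi => by simpa [hi] using hpos i
  refine ⟨?_, ?_, ?_, ?_, ?_⟩
  · have := hpos 0
    rw [h0] at this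
    exact this.trans_le (natDegree_C_mul_le _ _)
  · rintro rfl; exact hne 0 (by simp [h0])
  · rintro rfl; exact hne 1 (by simp [h1])
  · rintro rfl; exact absurd (hinj (h0.trans h1.symm)) (by decide)
  · rintro rfl
    have h2' : f 2 = C r * q := by simp [h2]
    refine ⟨?_, ?_, ?_⟩
    · rintro rfl; exact hne 2 (by simp [h2])
    · rintro rfl; exact absurd (hinj (h0.trans h2'.symm)) (by decide)
    · rintro rfl; exact absurd (hinj (h1.trans h2'.symm)) (by decide)

/-- Distinctness of three polynomials of the second special form, in terms of its parameters. -/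
theorem FormB.parameters_injective (hpos : ∀ i, 0 < (f i).natDegree) (hinj : Function.Injective f) {q : ℤ[X]}
    {k : ℤ} {l : Fin 3 → ℤ} (h : ∀ i, f i = C k * q ^ 2 + C (l i) * q) :
    0 < q.natDegree ∧ Function.Injective l ∧ (k = 0 → ∀ i, l i ≠ 0) := by
  have hne : ∀ i, f i ≠ 0 := fun i hi => by simpa [hi] using hpos i
  refine ⟨?_, ?_, ?_⟩
  · rw [Nat.pos_iff_ne_zero]
    intro hz
    have := hpos 0
    rw [h, eq_C_of_natDegree_eq_zero hz, ← C_pow, ← C_mul, ← C_mul, ← C_add, natDegree_C] at this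
    exact lt_irrefl _ this
  · intro i j hij
    exact hinj (by rw [h, h, hij])
  · rintro rfl i hi
    exact hne i (by simp [h, hi])

theorem exists_quadraticRelation_of_formA (hpos : ∀ i, 0 < (f i).natDegree)
    (hinj : Function.Injective f) (h : FormA f) :
    ∃ c w : Fin 3 → ℤ, c ≠ 0 ∧ QuadraticRelation f c w := by
  obtain ⟨q, k, l, m, r, h0, h1, h2⟩ := h
  obtain ⟨-, hl, hm, hlm, hk0⟩ := FormA.parameters_ne hpos hinj h0 h1 h2
  by_cases hk : k = 0
  · obtain ⟨hr, hlr, hmr⟩ := hk0 hk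
    -- the cross product of `(l, m, r)` and `(l ^ 2, m ^ 2, r ^ 2)`
    refine ⟨![m * r * (r - m), l * r * (l - r), l * m * (m - l)], 0, ?_, ?_, ?_⟩
    · intro hc
      exact mul_ne_zero (mul_ne_zero hm hr) (sub_ne_zero.mpr hmr.symm) (congrFun hc 0)
    · simp only [Fin.sum_univ_three, h0, h1, h2, hk, C_0, zero_mul, zero_add, C_mul, C_sub,
        Matrix.cons_val]
      ring
    · simp only [Fin.sum_univ_three, h0, h1, h2, hk, C_0, zero_mul, zero_add, C_mul, C_sub,
        Matrix.cons_val, Pi.zero_apply]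
      ring
  · -- `c` is orthogonal to `(l, m, 0)`, and `∑ c_i f_i ^ 2 = k l m (l - m) q ^ 2`
    refine ⟨![k * m, -(k * l), 0], ![m * (l - m) * r, 0, -(l * m * (l - m))], ?_, ?_, ?_⟩
    · intro hc
      exact mul_ne_zero hk hm (congrFun hc 0)
    · simp only [Fin.sum_univ_three, h0, h1, h2, C_0, zero_mul, C_mul, C_neg,
        Matrix.cons_val]
      ring
    · simp only [Fin.sum_univ_three, h0, h1, h2, C_0, zero_mul, zero_add, C_mul, C_sub, C_neg,
        Matrix.cons_val]
      ring

theorem exists_quadraticRelation_of_formB (hpos : ∀ i, 0 < (f i).natDegree)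
    (hinj : Function.Injective f) (h : FormB f) :
    ∃ c w : Fin 3 → ℤ, c ≠ 0 ∧ QuadraticRelation f c w := by
  obtain ⟨q, k, l, m, r, h0, h1, h2⟩ := h
  by_cases hk : k = 0
  · refine exists_quadraticRelation_of_formA hpos hinj ⟨q, 0, l, m, r, ?_, ?_, ?_⟩
    · simpa [hk] using h0
    · simpa [hk] using h1
    · simpa [hk] using h2
  · obtain ⟨-, hinjl, -⟩ := FormB.parameters_injective (l := ![l, m, r]) (k := k) (q := q) hpos hinj (by
      intro i; fin_cases i
      · exact h0
      · exact h1
      · exact h2)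
    have hmr : m ≠ r := fun h => absurd (hinjl (a₁ := 1) (a₂ := 2) h) (by decide)
    -- `c` is `k` times a vector orthogonal to `(1, 1, 1)` and `(l, m, r)`, and `∑ c_i f_i ^ 2 = k V q ^ 2` with
    -- `V = (l - m) (m - r) (l - r)`
    refine ⟨![k * (m - r), k * (r - l), k * (l - m)],
      ![m * (m - r) * (l - r), -(l * (m - r) * (l - r)), 0], ?_, ?_, ?_⟩
    · intro hc
      exact mul_ne_zero hk (sub_ne_zero.mpr hmr) (congrFun hc 0)
    · simp only [Fin.sum_univ_three, h0, h1, h2, C_mul, C_sub, Matrix.cons_val]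
      ring
    · simp only [Fin.sum_univ_three, h0, h1, h2, C_0, zero_mul, zero_add, C_mul, C_sub, C_neg,
        Matrix.cons_val]
      ring

theorem exists_quadraticRelation_of_hasSpecialForm (hpos : ∀ i, 0 < (f i).natDegree)
    (hinj : Function.Injective f) (h : HasSpecialForm f) :
    ∃ c w : Fin 3 → ℤ, c ≠ 0 ∧ QuadraticRelation f c w := by
  obtain ⟨σ, hσ⟩ := h
  have : ∃ c w : Fin 3 → ℤ, c ≠ 0 ∧ QuadraticRelation (fun i => f (σ i)) c w := hσ.elim
    (exists_quadraticRelation_of_formA (fun i => hpos _) (hinj.comp σ.injective))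
    (exists_quadraticRelation_of_formB (fun i => hpos _) (hinj.comp σ.injective))
  obtain ⟨c, w, hc, h⟩ := this
  refine ⟨fun i => c (σ.symm i), fun i => w (σ.symm i), fun hz => hc ?_, ?_⟩
  · funext i
    simpa using congrFun hz (σ i)
  · simpa using h.comp_perm σ.symm

/-- A linear relation between the polynomials, their squares and their cubes whose coefficients at
the cubes and squares are `2 μ c_i` and `3 μ w_i`. -/
def CubicRelation (f : Fin 3 → ℤ[X]) (c w : Fin 3 → ℤ) : Prop :=
  ∃ (μ : ℤ) (t : Fin 3 → ℤ), μ ≠ 0 ∧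
    ∑ i, (C (t i) * f i + C (3 * μ * w i) * f i ^ 2 + C (2 * μ * c i) * f i ^ 3) = 0

theorem CubicRelation.comp_perm {c w : Fin 3 → ℤ}
    (h : CubicRelation f c w) (σ : Equiv.Perm (Fin 3)) :
    CubicRelation (fun i => f (σ i)) (fun i => c (σ i)) (fun i => w (σ i)) := by
  obtain ⟨μ, t, hμ, h⟩ := h
  exact ⟨μ, fun i => t (σ i), hμ, (Equiv.sum_comp σ fun i =>
    C (t i) * f i + C (3 * μ * w i) * f i ^ 2 + C (2 * μ * c i) * f i ^ 3).trans h⟩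

/-- The coefficients of the powers of `q` in the three relations give the moments of `c` of orders
`0`, `1`, `2` (orders `1`, `2`, `3` if `k = 0`) with respect to the distinct nodes `l i`. -/
theorem eq_zero_of_cubicRelation_of_formB (hpos : ∀ i, 0 < (f i).natDegree)
    (hinj : Function.Injective f) (h : FormB f) {c w : Fin 3 → ℤ} (hq : QuadraticRelation f c w)
    (hc : CubicRelation f c w) : c = 0 := by
  obtain ⟨q, k, l₀, l₁, l₂, h0, h1, h2⟩ := h
  obtain ⟨l, hl⟩ : ∃ l : Fin 3 → ℤ, l = ![l₀, l₁, l₂] := ⟨_, rfl⟩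
  have hf : ∀ i, f i = C k * q ^ 2 + C (l i) * q := by
    intro i; subst hl; fin_cases i
    · exact h0
    · exact h1
    · exact h2
  obtain ⟨hqd, hlinj, hl0⟩ := FormB.parameters_injective hpos hinj hf
  obtain ⟨e1, e2⟩ := hq
  obtain ⟨μ, t, hμ, e3⟩ := hc
  simp only [Fin.sum_univ_three, hf] at e1 e2 e3
  have k1 := coeff_eq_zero_of_sum_pow_eq_zero hqd
    (a₁ := c 0 * l 0 + c 1 * l 1 + c 2 * l 2) (a₂ := k * (c 0 + c 1 + c 2))
    (a₃ := 0) (a₄ := 0) (a₅ := 0) (a₆ := 0) (by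
      simp only [C_add, C_mul, C_0]; linear_combination e1)
  have k2 := coeff_eq_zero_of_sum_pow_eq_zero hqd
    (a₁ := w 0 * l 0 + w 1 * l 1 + w 2 * l 2)
    (a₂ := k * (w 0 + w 1 + w 2) + (c 0 * l 0 ^ 2 + c 1 * l 1 ^ 2 + c 2 * l 2 ^ 2))
    (a₃ := 2 * k * (c 0 * l 0 + c 1 * l 1 + c 2 * l 2)) (a₄ := k ^ 2 * (c 0 + c 1 + c 2))
    (a₅ := 0) (a₆ := 0) (by
      simp only [C_add, C_mul, C_0, C_pow, C_ofNat]; linear_combination e2)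
  have k3 := coeff_eq_zero_of_sum_pow_eq_zero hqd
    (a₁ := t 0 * l 0 + t 1 * l 1 + t 2 * l 2)
    (a₂ := k * (t 0 + t 1 + t 2) + 3 * μ * (w 0 * l 0 ^ 2 + w 1 * l 1 ^ 2 + w 2 * l 2 ^ 2))
    (a₃ := 6 * μ * k * (w 0 * l 0 + w 1 * l 1 + w 2 * l 2)
      + 2 * μ * (c 0 * l 0 ^ 3 + c 1 * l 1 ^ 3 + c 2 * l 2 ^ 3))
    (a₄ := 3 * μ * k ^ 2 * (w 0 + w 1 + w 2)
      + 6 * μ * k * (c 0 * l 0 ^ 2 + c 1 * l 1 ^ 2 + c 2 * l 2 ^ 2))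
    (a₅ := 6 * μ * k ^ 2 * (c 0 * l 0 + c 1 * l 1 + c 2 * l 2))
    (a₆ := 2 * μ * k ^ 3 * (c 0 + c 1 + c 2)) (by
      simp only [C_add, C_mul, C_pow, C_ofNat] at e3 ⊢; linear_combination e3)
  by_cases hk : k = 0
  · subst hk
    refine eq_zero_of_vandermonde' hlinj (hl0 rfl) k1.1 (by linear_combination k2.2.1) ?_
    have h := k3.2.2.1
    have h' : (2 * μ) * (c 0 * l 0 ^ 3 + c 1 * l 1 ^ 3 + c 2 * l 2 ^ 3) = 0 := by
      linear_combination h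
    exact (mul_eq_zero.mp h').resolve_left (by simpa using hμ)
  · refine eq_zero_of_vandermonde hlinj ((mul_eq_zero.mp k1.2.1).resolve_left hk) k1.1 ?_
    have h : (3 * μ * k) * (c 0 * l 0 ^ 2 + c 1 * l 1 ^ 2 + c 2 * l 2 ^ 2) = 0 := by
      linear_combination k3.2.2.2.1 - 3 * μ * k * k2.2.1
    exact (mul_eq_zero.mp h).resolve_left (by simp [hμ, hk])

theorem eq_zero_of_cubicRelation_of_formA (hpos : ∀ i, 0 < (f i).natDegree)
    (hinj : Function.Injective f) (h : FormA f) {c w : Fin 3 → ℤ} (hq : QuadraticRelation f c w)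
    (hc : CubicRelation f c w) : c = 0 := by
  obtain ⟨q, k, l, m, r, h0, h1, h2⟩ := h
  obtain ⟨hqd, hl, hm, hlm, -⟩ := FormA.parameters_ne hpos hinj h0 h1 h2
  by_cases hk : k = 0
  · refine eq_zero_of_cubicRelation_of_formB hpos hinj ⟨q, 0, l, m, r, ?_, ?_, ?_⟩ hq hc
    · simpa using h0
    · simpa using h1
    · simpa [hk] using h2
  obtain ⟨e1, e2⟩ := hq
  obtain ⟨μ, t, hμ, e3⟩ := hc
  simp only [Fin.sum_univ_three, h0, h1, h2] at e1 e2 e3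
  have k1 := coeff_eq_zero_of_sum_pow_eq_zero hqd
    (a₁ := c 0 * l + c 1 * m + c 2 * r) (a₂ := k * c 2)
    (a₃ := 0) (a₄ := 0) (a₅ := 0) (a₆ := 0) (by
      simp only [C_add, C_mul, C_0]; linear_combination e1)
  have hc2 : c 2 = 0 := (mul_eq_zero.mp k1.2.1).resolve_left hk
  have hlin : c 0 * l + c 1 * m = 0 := by simpa [hc2] using k1.1
  rw [hc2] at e2 e3
  have k2 := coeff_eq_zero_of_sum_pow_eq_zero hqd
    (a₁ := w 0 * l + w 1 * m + w 2 * r) (a₂ := k * w 2 + (c 0 * l ^ 2 + c 1 * m ^ 2))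
    (a₃ := 0) (a₄ := 0) (a₅ := 0) (a₆ := 0) (by
      simp only [C_add, C_mul, C_0, C_pow] at e2 ⊢; linear_combination e2)
  have k3 := coeff_eq_zero_of_sum_pow_eq_zero hqd
    (a₁ := t 0 * l + t 1 * m + t 2 * r)
    (a₂ := k * t 2 + 3 * μ * (w 0 * l ^ 2 + w 1 * m ^ 2 + w 2 * r ^ 2))
    (a₃ := 6 * μ * k * r * w 2 + 2 * μ * (c 0 * l ^ 3 + c 1 * m ^ 3))
    (a₄ := 3 * μ * k ^ 2 * w 2) (a₅ := 0) (a₆ := 0) (by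
      simp only [C_add, C_mul, C_0, C_pow, C_ofNat, mul_zero] at e3 ⊢; linear_combination e3)
  have hw2 : w 2 = 0 :=
    (mul_eq_zero.mp k3.2.2.2.1).resolve_left (by simp [hμ, hk])
  have hsq : c 0 * l ^ 2 + c 1 * m ^ 2 = 0 := by simpa [hw2] using k2.2.1
  have hc0 : c 0 * (l * (l - m)) = 0 := by linear_combination hsq - m * hlin
  have hc1 : c 1 * (m * (m - l)) = 0 := by linear_combination hsq - l * hlin
  have hc0' := (mul_eq_zero.mp hc0).resolve_right (mul_ne_zero hl (sub_ne_zero.mpr hlm))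
  have hc1' := (mul_eq_zero.mp hc1).resolve_right (mul_ne_zero hm (sub_ne_zero.mpr hlm.symm))
  funext i
  fin_cases i
  · exact hc0'
  · exact hc1'
  · exact hc2

theorem eq_zero_of_cubicRelation (hpos : ∀ i, 0 < (f i).natDegree)
    (hinj : Function.Injective f) (h : HasSpecialForm f) {c w : Fin 3 → ℤ}
    (hq : QuadraticRelation f c w) (hc : CubicRelation f c w) : c = 0 := by
  obtain ⟨σ, hσ⟩ := h
  have : (fun i => c (σ i)) = 0 := hσ.elim
    (fun h => eq_zero_of_cubicRelation_of_formA (fun i => hpos _) (hinj.comp σ.injective) h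
      (hq.comp_perm σ) (hc.comp_perm σ))
    (fun h => eq_zero_of_cubicRelation_of_formB (fun i => hpos _) (hinj.comp σ.injective) h
      (hq.comp_perm σ) (hc.comp_perm σ))
  funext i
  simpa using congrFun this (σ.symm i)

end

/-! ### Annihilating characters from the top coordinate down -/

theorem charRow_cons {d k : ℕ} (M : Matrix (Fin d) (Fin d) ℤ) (f : Fin k → ℤ[X])
    (u : Fin (k + 1) → Fin d → ℤ) :
    charRow M (Fin.cons 0 f : Fin (k + 1) → ℤ[X]) u = charRow M f fun i => u i.succ := by
  funext l
  rw [charRow_apply, charRow_apply, Fin.sum_univ_succ]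
  simp [comp_zero, binomPoly_eval_zero]

open Matrix in
theorem charRow_apply_of_add_eq {d k : ℕ} (M : Matrix (Fin d) (Fin d) ℤ) (f : Fin k → ℤ[X])
    (v : Fin k → Fin d → ℤ) {e : Fin d} (hv : ∀ i l, e < l → v i l = 0) {l : Fin d} {j : ℕ}
    (hl : l.val + j = e.val) : charRow M f v l =
      ∑ i, ∑ m ∈ Finset.range (j + 1),
        (binomPoly (m + 1)).comp ((f i).map (Int.castRingHom ℚ)) *
          C (((v i ᵥ* strictLower ℤ M ^ m) l : ℤ) : ℚ) := by
  rw [charRow_apply]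
  refine Finset.sum_congr rfl fun i _ => (Finset.sum_subset ?_ fun m _ hm => ?_).symm
  · exact Finset.range_subset_range.mpr (by have := e.isLt; omega)
  · rw [vecMul_strictLower_pow_eq_zero M (v i) (e.val + 1) m
      (fun l hl => hv i l (Fin.lt_def.mpr hl)) l (by
        rw [Finset.mem_range, not_lt] at hm; omega)]
    simp

open Matrix in
theorem vecMul_strictLower_apply_of_add_one {d : ℕ} (M : Matrix (Fin d) (Fin d) ℤ) (v : Fin d → ℤ)
    {e l : Fin d} (hv : ∀ s, e < s → v s = 0) (hl : l.val + 1 = e.val) :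
    (v ᵥ* strictLower ℤ M) l = v e * M e l := by
  rw [vecMul, dotProduct, Finset.sum_eq_single e]
  · rw [strictLower_apply, if_pos (Fin.lt_def.mpr (by omega)), Int.cast_id]
  · intro s _ hs
    rw [strictLower_apply]
    split_ifs with h
    · have h1 : l.val < s.val := h
      have h2 : s.val ≠ e.val := fun h => hs (Fin.ext h)
      rw [hv s (Fin.lt_def.mpr (by omega)), zero_mul]
    · rw [mul_zero]
  · exact fun h => absurd (Finset.mem_univ e) h

open Matrix in
theorem vecMul_strictLower_apply_of_add_two {d : ℕ} (M : Matrix (Fin d) (Fin d) ℤ) (v : Fin d → ℤ)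
    {e l l' : Fin d} (hv : ∀ s, e < s → v s = 0) (hl : l.val + 1 = e.val)
    (hl' : l'.val + 1 = l.val) :
    (v ᵥ* strictLower ℤ M) l' = v l * M l l' + v e * M e l' := by
  have hne : l ≠ e := fun h => by subst h; omega
  rw [vecMul, dotProduct, Fintype.sum_eq_add l e hne]
  · rw [strictLower_apply, strictLower_apply, if_pos (Fin.lt_def.mpr (by omega)),
      if_pos (Fin.lt_def.mpr (by omega)), Int.cast_id, Int.cast_id]
  · rintro s ⟨hs1, hs2⟩
    rw [strictLower_apply]
    split_ifs with h
    · have h1 : l'.val < s.val := h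
      have h2 : s.val ≠ e.val := fun h => hs2 (Fin.ext h)
      have h3 : s.val ≠ l.val := fun h => hs1 (Fin.ext h)
      rw [hv s (Fin.lt_def.mpr (by omega)), zero_mul]
    · rw [mul_zero]

theorem binomPoly_one_comp (F : ℚ[X]) : (binomPoly 1).comp F = F := by
  simp [binomPoly]

theorem two_mul_binomPoly_two_comp (F : ℚ[X]) : 2 * (binomPoly 2).comp F = F ^ 2 - F := by
  have h : (2 : ℚ[X]) * C ((2 : ℚ)⁻¹) = 1 := by
    rw [← C_ofNat, ← C_mul]; norm_num
  have e : (binomPoly 2).comp F = C ((2 : ℚ)⁻¹) * (F * (F - 1)) := by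
    simp [binomPoly, descPochhammer_succ_right]
  rw [e]
  linear_combination (F * (F - 1)) * h

theorem six_mul_binomPoly_three_comp (F : ℚ[X]) :
    6 * (binomPoly 3).comp F = F ^ 3 - 3 * F ^ 2 + 2 * F := by
  have h : (6 : ℚ[X]) * C ((6 : ℚ)⁻¹) = 1 := by
    rw [← C_ofNat, ← C_mul]; norm_num
  have e : (binomPoly 3).comp F = C ((6 : ℚ)⁻¹) * (F * (F - 1) * (F - 2)) := by
    simp [binomPoly, descPochhammer_succ_right, Nat.factorial]
  rw [e]
  linear_combination (F * (F - 1) * (F - 2)) * h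

section
variable {d k : ℕ} {M : Matrix (Fin d) (Fin d) ℤ} {f : Fin k → ℤ[X]} {v : Fin k → Fin d → ℤ}
  {e l l' : Fin d}

open Matrix

/-- The top nonzero coefficients of an annihilating character form a linear relation. -/
theorem sum_top_eq_zero (hR : charRow M f v = 0) (hv : ∀ i l, e < l → v i l = 0) :
    ∑ i, C (v i e) * f i = 0 := by
  have h := charRow_apply_of_add_eq M f v hv (l := e) (j := 0) rfl
  rw [hR] at h
  apply map_injective (Int.castRingHom ℚ) Int.cast_injective
  rw [Polynomial.map_zero, Polynomial.map_sum]
  refine Eq.trans (Finset.sum_congr rfl fun i _ => ?_) h.symm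
  rw [zero_add, Finset.sum_range_one, binomPoly_one_comp, pow_zero, vecMul_one, Polynomial.map_mul,
    map_C]
  exact mul_comm _ _

/-- The coefficients of an annihilating character in the two top positions form a quadratic
relation. -/
theorem sum_second_eq_zero (hR : charRow M f v = 0) (hv : ∀ i l, e < l → v i l = 0)
    (hl : l.val + 1 = e.val) :
    ∑ i, (C (2 * v i l - M e l * v i e) * f i + C (M e l * v i e) * f i ^ 2) = 0 := by
  have h := charRow_apply_of_add_eq M f v hv hl
  rw [hR] at h
  apply map_injective (Int.castRingHom ℚ) Int.cast_injective
  rw [Polynomial.map_zero, Polynomial.map_sum]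
  have h2 := congrArg (fun g => 2 * g) h.symm
  simp only [Pi.zero_apply, mul_zero, Finset.mul_sum] at h2
  refine Eq.trans (Finset.sum_congr rfl fun i _ => ?_) h2
  have hB := two_mul_binomPoly_two_comp ((f i).map (Int.castRingHom ℚ))
  rw [Finset.sum_range_succ, Finset.sum_range_one, zero_add, binomPoly_one_comp, pow_zero,
    vecMul_one, pow_one, vecMul_strictLower_apply_of_add_one M (v i) (hv i) hl]
  simp only [C_sub, C_mul, C_ofNat, Int.cast_mul, Polynomial.map_add, Polynomial.map_sub,
    Polynomial.map_mul, Polynomial.map_pow, Polynomial.map_ofNat, map_C, Int.coe_castRingHom]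
  linear_combination -(C (v i e : ℚ) * C (M e l : ℚ)) * hB

/-- The coefficients of an annihilating character in the three top positions form a cubic
relation. -/
theorem sum_third_eq_zero (hR : charRow M f v = 0) (hv : ∀ i l, e < l → v i l = 0)
    (hl : l.val + 1 = e.val) (hl' : l'.val + 1 = l.val) :
    ∃ t : Fin k → ℤ, ∑ i, (C (t i) * f i + C (3 * (M e l * M l l') * (2 * v i l - M e l * v i e)) *
      f i ^ 2 + C (2 * (M e l * M l l') * (M e l * v i e)) * f i ^ 3) = 0 := by
  have h := charRow_apply_of_add_eq M f v hv (l := l') (j := 2) (by omega)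
  rw [hR] at h
  have hsec := sum_second_eq_zero hR hv hl
  -- `12 M e l` times the third relation, corrected by a multiple of the second one so that the
  -- coefficients of the squares match
  let κ : ℤ := 6 * M e l' - 3 * (M e l * M l l')
  refine ⟨fun i => 12 * M e l * v i l' - 6 * M e l * (M l l' * v i l + M e l' * v i e)
    + 4 * M e l * (M e l * M l l' * v i e) - κ * (2 * v i l - M e l * v i e), ?_⟩
  apply map_injective (Int.castRingHom ℚ) Int.cast_injective
  rw [Polynomial.map_zero, Polynomial.map_sum]
  have h2 := congrArg (fun g => C ((12 * M e l : ℤ) : ℚ) * g) h.symm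
  have h3 := congrArg (fun g => C (κ : ℚ) * g.map (Int.castRingHom ℚ)) hsec
  simp only [Pi.zero_apply, mul_zero, Finset.mul_sum, Polynomial.map_zero, Polynomial.map_sum]
    at h2 h3
  have h4 := congrArg₂ (fun a b => a - b) h2 h3
  simp only [sub_zero, ← Finset.sum_sub_distrib] at h4
  refine Eq.trans (Finset.sum_congr rfl fun i _ => ?_) h4
  have hB := two_mul_binomPoly_two_comp ((f i).map (Int.castRingHom ℚ))
  have hB' := six_mul_binomPoly_three_comp ((f i).map (Int.castRingHom ℚ))
  have hN : ∀ s, l < s → (v i ᵥ* strictLower ℤ M) s = 0 := fun s hs => by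
    have := vecMul_strictLower_pow_eq_zero M (v i) (e.val + 1) 1
      (fun l hl => hv i l (Fin.lt_def.mpr hl)) s (by have := Fin.lt_def.mp hs; omega)
    rwa [pow_one] at this
  rw [Finset.sum_range_succ, Finset.sum_range_succ, Finset.sum_range_one, zero_add,
    binomPoly_one_comp, pow_zero, vecMul_one, pow_one,
    vecMul_strictLower_apply_of_add_two M (v i) (hv i) hl hl', sq (strictLower ℤ M), ← vecMul_vecMul,
    vecMul_strictLower_apply_of_add_one M _ hN hl',
    vecMul_strictLower_apply_of_add_one M (v i) (hv i) hl]
  simp only [κ, C_sub, C_add, C_mul, C_ofNat, Int.cast_sub, Int.cast_mul, Int.cast_add,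
    Int.cast_ofNat, Polynomial.map_add, Polynomial.map_sub, Polynomial.map_mul, Polynomial.map_pow,
    Polynomial.map_ofNat, map_C, Int.coe_castRingHom]
  linear_combination -6 * C (M e l : ℚ) * (C (v i l : ℚ) * C (M l l' : ℚ)
    + C (v i e : ℚ) * C (M e l' : ℚ)) * hB
    - 2 * C (M e l : ℚ) * (C (v i e : ℚ) * C (M e l : ℚ) * C (M l l' : ℚ)) * hB'

end

/-! ### Values of the Weyl complexity -/

/-- It is enough to look at the last coordinate involved in an annihilating character. -/
theorem weylProperty_of_top {k : ℕ} (f : Fin k → ℤ[X]) (hf : ∀ i, (f i).eval 0 = 0) (r : ℕ)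
    (h : ∀ (d : ℕ) (M : Matrix (Fin d) (Fin d) ℤ), (∀ i j : Fin d, j.val + 1 = i.val → M i j ≠ 0) →
      ∀ v : Fin k → Fin d → ℤ, charRow M f v = 0 → ∀ e : Fin d, r ≤ e.val + 1 →
        (∀ i l, e < l → v i l = 0) → ∀ i, v i e = 0) : WeylProperty f r := by
  refine weylProperty_of_charRow f hf r fun d _ α M hS u hsum hR => ?_
  rw [charRow_cons] at hR
  have key : ∀ l : Fin d, r ≤ l.val + 1 → ∀ i : Fin k, u i.succ l = 0 := by
    by_contra! hcon
    obtain ⟨l, hl, i, hi⟩ := hcon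
    obtain ⟨e, he, hmax⟩ := Finset.exists_max_image
      (Finset.univ.filter fun l : Fin d => ∃ i : Fin k, u i.succ l ≠ 0) id
      ⟨l, Finset.mem_filter.mpr ⟨Finset.mem_univ l, i, hi⟩⟩
    have hle : l ≤ e := hmax l (Finset.mem_filter.mpr ⟨Finset.mem_univ l, i, hi⟩)
    obtain ⟨-, j, hj⟩ := Finset.mem_filter.mp he
    refine hj (h d M hS.2 (fun i => u i.succ) hR e (hl.trans (Nat.succ_le_succ hle))
      (fun i' l' hl' => ?_) j)
    by_contra hne
    exact absurd (hmax l' (Finset.mem_filter.mpr ⟨Finset.mem_univ l', i', hne⟩)) (not_le.mpr hl')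
  intro i l hl
  refine Fin.cases ?_ (fun j => key l hl j) i
  have := hsum l
  rw [Fin.sum_univ_succ, Finset.sum_eq_zero (fun j _ => key l hl j), add_zero] at this
  exact this

theorem weylProperty_one {k : ℕ} (f : Fin k → ℤ[X]) (hf : ∀ i, (f i).eval 0 = 0)
    (h : LinearIndependent ℤ f) : WeylProperty f 1 :=
  weylProperty_of_top f hf 1 fun _ _ _ v hR e _ hv =>
    Fintype.linearIndependent_iff.mp h (fun i => v i e) (by
      simpa only [smul_eq_C_mul] using sum_top_eq_zero hR hv)

theorem quadraticRelation_top {d : ℕ} {M : Matrix (Fin d) (Fin d) ℤ} {f : Fin 3 → ℤ[X]}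
    {v : Fin 3 → Fin d → ℤ} {e l : Fin d} (hR : charRow M f v = 0)
    (hv : ∀ i l, e < l → v i l = 0) (hl : l.val + 1 = e.val) :
    QuadraticRelation f (fun i => M e l * v i e) (fun i => 2 * v i l - M e l * v i e) := by
  refine ⟨?_, sum_second_eq_zero hR hv hl⟩
  have := congrArg (fun g => C (M e l) * g) (sum_top_eq_zero hR hv)
  simpa only [Finset.mul_sum, mul_zero, ← mul_assoc, ← C_mul] using this

theorem weylProperty_two (f : Fin 3 → ℤ[X]) (hf : ∀ i, (f i).eval 0 = 0)
    (hpos : ∀ i, 0 < (f i).natDegree) (hinj : Function.Injective f) (h : ¬ HasSpecialForm f) :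
    WeylProperty f 2 := by
  refine weylProperty_of_top f hf 2 fun d M hM v hR e he hv => ?_
  let l : Fin d := ⟨e.val - 1, by omega⟩
  have hl : l.val + 1 = e.val := by simp only [l]; omega
  by_contra! hne
  obtain ⟨i, hi⟩ := hne
  refine h (hasSpecialForm_of_quadraticRelation (fun i => ?_) hpos hinj (fun hz => ?_)
    (quadraticRelation_top hR hv hl))
  · rw [coeff_zero_eq_eval_zero, hf]
  · exact mul_ne_zero (hM e l hl) hi (congrFun hz i)

theorem weylProperty_three (f : Fin 3 → ℤ[X]) (hf : ∀ i, (f i).eval 0 = 0)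
    (hpos : ∀ i, 0 < (f i).natDegree) (hinj : Function.Injective f) (h : HasSpecialForm f) :
    WeylProperty f 3 := by
  refine weylProperty_of_top f hf 3 fun d M hM v hR e he hv i => ?_
  let l : Fin d := ⟨e.val - 1, by omega⟩
  have hl : l.val + 1 = e.val := by simp only [l]; omega
  let l' : Fin d := ⟨e.val - 2, by omega⟩
  have hl' : l'.val + 1 = l.val := by simp only [l, l']; omega
  have hc := eq_zero_of_cubicRelation hpos hinj h (quadraticRelation_top hR hv hl)
    ⟨M e l * M l l', (sum_third_eq_zero hR hv hl hl').choose, mul_ne_zero (hM _ _ hl) (hM _ _ hl'),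
      (sum_third_eq_zero hR hv hl hl').choose_spec⟩
  exact (mul_eq_zero.mp (congrFun hc i)).resolve_left (hM _ _ hl)

/-- A character annihilating the orbit annihilates its closure, so it must be trivial on every
subgroup contained in the closure. -/
theorem not_weylProperty_of_character {k d r : ℕ} {f : Fin k → ℤ[X]} (hd : r ≤ d) {α : Fin d → ℝ}
    {M : Matrix (Fin d) (Fin d) ℤ} (hS : IsQuasiStandard α M) (u : Fin (k + 1) → Fin d → ℤ)
    (hu : ∀ y ∈ orbit f (weylEquiv α M), ∑ i, ∑ l, u i l • y i l = 0)
    {i₀ : Fin (k + 1)} {l₀ : Fin d} (hl₀ : r ≤ l₀.val + 1) (hne : u i₀ l₀ ≠ 0) :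
    ¬ WeylProperty f r := by
  intro hW
  let t : UnitAddCircle := ((1 / (2 * u i₀ l₀) : ℝ) : UnitAddCircle)
  let y : Fin (k + 1) → Fin d → UnitAddCircle := Pi.single i₀ (Pi.single l₀ t)
  have hy : y ∈ closure (orbit f (weylEquiv α M)) := by
    refine hW d hd α M hS fun i l hl => ?_
    have hll : l ≠ l₀ := by rintro rfl; omega
    by_cases hi : i = i₀
    · subst hi; simp [y, hll]
    · simp [y, hi]
  have hclosed : IsClosed {y : Fin (k + 1) → Fin d → UnitAddCircle |
      ∑ i, ∑ l, u i l • y i l = 0} := by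
    refine isClosed_eq ?_ continuous_const
    fun_prop
  have h0 : ∑ i, ∑ l, u i l • y i l = 0 := closure_minimal hu hclosed hy
  have h1 : ∑ i, ∑ l, u i l • y i l = u i₀ l₀ • t := by
    rw [Finset.sum_eq_single i₀ _ (fun h => absurd (Finset.mem_univ _) h),
      Finset.sum_eq_single l₀ _ (fun h => absurd (Finset.mem_univ _) h)]
    · simp [y]
    · intro l _ hl; simp [y, hl]
    · intro i _ hi; simp [y, hi]
  have hne' : (u i₀ l₀ : ℝ) ≠ 0 := by exact_mod_cast hne
  have h2 : u i₀ l₀ • t = ((1 / 2 : ℝ) : UnitAddCircle) := by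
    simp only [t]
    rw [← AddCircle.coe_zsmul, zsmul_eq_mul]
    congr 1
    field_simp
  rw [h1, h2] at h0
  have h3 := (AddCircle.norm_eq (p := 1) (x := (1 / 2 : ℝ))).symm
  rw [h0, norm_zero] at h3
  norm_num at h3

theorem linearIndependent_of_weylProperty_one {k : ℕ} {f : Fin k → ℤ[X]} (h : WeylProperty f 1) :
    LinearIndependent ℤ f := by
  rw [Fintype.linearIndependent_iff]
  intro c hc
  simp only [smul_eq_C_mul] at hc
  by_contra! hne
  obtain ⟨i, hi⟩ := hne
  -- the rotation by `√2`
  let α : Fin 1 → ℝ := fun _ => √2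
  have hS : IsQuasiStandard α (0 : Matrix (Fin 1) (Fin 1) ℤ) :=
    ⟨fun _ _ => irrational_sqrt_two, fun i j hij => by omega⟩
  refine not_weylProperty_of_character (l₀ := 0) (i₀ := i.succ) le_rfl hS
    (Fin.cons (fun _ => -∑ i, c i) fun i _ => c i) ?_ (by simp) (by simpa using hi) h
  rintro y ⟨x, n, -, rfl⟩
  have hT : ∀ z : ℤ, (weylEquiv α 0 ^ z) x = fun l => x l + z • ((√2 : ℝ) : UnitAddCircle) := by
    intro z
    have := zpow_apply_of_step (weylEquiv α 0)
      (fun z : ℤ => fun l => x l + z • ((√2 : ℝ) : UnitAddCircle)) (fun z => by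
        funext l
        simp only [weylEquiv, Equiv.ofBijective_apply, weylMap, α, Matrix.zero_apply, zero_smul,
          Finset.sum_const_zero]
        module) z
    simpa using this
  have hev : ∑ i, c i * (f i).eval (n : ℤ) = 0 := by
    have := congrArg (eval (n : ℤ)) hc
    simpa [eval_finsetSum] using this
  simp only [Fin.sum_univ_succ, Fin.cons_zero, Fin.cons_succ, hT, Finset.univ_eq_empty,
    Finset.sum_empty, add_zero, smul_add, Finset.sum_add_distrib, ← Finset.sum_smul, smul_smul, hev]
  module

theorem not_weylProperty_two_of_quadraticRelation {f : Fin 3 → ℤ[X]} {c w : Fin 3 → ℤ} (hc : c ≠ 0)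
    (h : QuadraticRelation f c w) : ¬ WeylProperty f 2 := by
  obtain ⟨i, hi⟩ := Function.ne_iff.mp hc
  -- the system `(x₁, x₂) ↦ (x₁ + √2, x₂ + 2 x₁ + √2)`, with
  -- `T ^ n (x₁, x₂) = (x₁ + n √2, x₂ + 2 n x₁ + n ^ 2 √2)`
  let α : Fin 2 → ℝ := fun _ => √2
  let M : Matrix (Fin 2) (Fin 2) ℤ := fun _ _ => 2
  have hS : IsQuasiStandard α M := ⟨fun _ _ => irrational_sqrt_two, fun _ _ _ => two_ne_zero⟩
  refine not_weylProperty_of_character (l₀ := 1) (i₀ := i.succ) le_rfl hS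
    (Fin.cons ![-∑ i, w i, -∑ i, c i] fun i => ![w i, c i]) ?_ (by simp) (by simpa using hi)
  rintro y ⟨x, n, -, rfl⟩
  set a : UnitAddCircle := ((√2 : ℝ) : UnitAddCircle) with ha
  have hT : ∀ z : ℤ, (weylEquiv α M ^ z) x = ![x 0 + z • a, x 1 + (2 * z) • x 0 + (z ^ 2) • a] := by
    intro z
    have := zpow_apply_of_step (weylEquiv α M)
      (fun z : ℤ => ![x 0 + z • a, x 1 + (2 * z) • x 0 + (z ^ 2) • a]) (fun z => by
        have h0 : Finset.Iio (0 : Fin 2) = ∅ := by decide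
        have h1 : Finset.Iio (1 : Fin 2) = {0} := by decide
        funext l
        fin_cases l
        · simp only [weylEquiv, Equiv.ofBijective_apply, weylMap, α, Fin.zero_eta, h0,
            Finset.sum_empty, ← ha, Matrix.cons_val]
          module
        · simp only [weylEquiv, Equiv.ofBijective_apply, weylMap, α, Fin.mk_one, h1, M,
            Finset.sum_singleton, ← ha, Matrix.cons_val]
          module) z
    rw [← this]
    congr 1
    funext l
    fin_cases l <;> simp
  have hev1 := congrArg (eval (n : ℤ)) h.1
  have hev2 := congrArg (eval (n : ℤ)) h.2
  simp only [Fin.sum_univ_three, eval_add, eval_mul, eval_C, eval_pow, eval_zero] at hev1 hev2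
  have e1 : (2 * (c 0 * eval (n : ℤ) (f 0) + c 1 * eval (n : ℤ) (f 1)
      + c 2 * eval (n : ℤ) (f 2))) • x 0 = 0 := by rw [hev1, mul_zero, zero_smul]
  have e2 := congrArg (fun z : ℤ => z • a) hev2
  simp only [zero_smul] at e2
  rw [Fin.sum_univ_succ]
  simp only [Fin.sum_univ_three, Fin.sum_univ_two, Fin.cons_zero, Fin.cons_succ, hT,
    Matrix.cons_val]
  refine Eq.trans ?_ ((congrArg₂ (fun s t => s + t) e1 e2).trans (add_zero 0))
  module

theorem not_linearIndependent_of_quadraticRelation {f : Fin 3 → ℤ[X]} {c w : Fin 3 → ℤ}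
    (hc : c ≠ 0) (h : QuadraticRelation f c w) : ¬ LinearIndependent ℤ f := fun hli =>
  hc (funext (Fintype.linearIndependent_iff.mp hli c (by simpa only [smul_eq_C_mul] using h.1)))

theorem tilde_eval_zero (p : ℤ[X]) : (tilde p).eval 0 = 0 := by simp [tilde]

theorem natDegree_tilde_pos {p : ℤ[X]} (h : ∀ c : ℤ, p ≠ C c) : 0 < (tilde p).natDegree := by
  rw [Nat.pos_iff_ne_zero]
  intro h0
  refine h ((tilde p).coeff 0 + p.eval 0) ?_
  rw [C_add, ← eq_C_of_natDegree_eq_zero h0, tilde, sub_add_cancel]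

theorem weylComplexity_eq {k : ℕ} {p : Fin k → ℤ[X]} {r : ℕ} (hr : 1 ≤ r)
    (h : WeylProperty (fun i => tilde (p i)) r)
    (hlt : ∀ s, 1 ≤ s → s < r → ¬ WeylProperty (fun i => tilde (p i)) s) :
    weylComplexity p = r :=
  le_antisymm (Nat.sInf_le ⟨hr, h⟩) (le_csInf ⟨r, hr, h⟩ fun s hs => by
    by_contra hcon
    exact hlt s hs.1 (not_le.mp hcon) hs.2)

theorem weylProperty_weylComplexity {k : ℕ} {p : Fin k → ℤ[X]} (h : 0 < weylComplexity p) :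
    WeylProperty (fun i => tilde (p i)) (weylComplexity p) :=
  (Nat.sInf_mem (Nat.nonempty_of_pos_sInf h)).2

end WeylComplexity

theorem propositionT (p : Fin 3 → Polynomial ℤ)
    (hp : WeylComplexity.EssentiallyDistinct p) :
    (WeylComplexity.weylComplexity p = 1 ↔
      LinearIndependent ℤ (fun i => WeylComplexity.tilde (p i))) ∧
    (WeylComplexity.weylComplexity p = 3 ↔
      WeylComplexity.HasSpecialForm (fun i => WeylComplexity.tilde (p i))) ∧
    (¬ LinearIndependent ℤ (fun i => WeylComplexity.tilde (p i)) →
      ¬ WeylComplexity.HasSpecialForm (fun i => WeylComplexity.tilde (p i)) →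
      WeylComplexity.weylComplexity p = 2) := by
  set f : Fin 3 → ℤ[X] := fun i => WeylComplexity.tilde (p i) with hfdef
  have hf : ∀ i, (f i).eval 0 = 0 := fun i => WeylComplexity.tilde_eval_zero _
  have hpos : ∀ i, 0 < (f i).natDegree := fun i => WeylComplexity.natDegree_tilde_pos (hp.1 i)
  have hinj : Function.Injective f := by
    intro i j hij
    by_contra hne
    refine hp.2 i j hne ((p i).eval 0 - (p j).eval 0) ?_
    simp only [hfdef, WeylComplexity.tilde] at hij
    rw [C_sub]
    linear_combination hij
  have h2 : ¬ WeylComplexity.HasSpecialForm f → WeylComplexity.weylComplexity p ≤ 2 := fun h =>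
    Nat.sInf_le ⟨one_le_two, WeylComplexity.weylProperty_two f hf hpos hinj h⟩
  refine ⟨⟨fun h => ?_, fun h => ?_⟩, ⟨fun h => ?_, fun h => ?_⟩, fun hli hsp => ?_⟩
  · have := WeylComplexity.weylProperty_weylComplexity (p := p) (by omega)
    rw [h] at this
    exact WeylComplexity.linearIndependent_of_weylProperty_one this
  · exact WeylComplexity.weylComplexity_eq le_rfl (WeylComplexity.weylProperty_one f hf h)
      fun s h1 h2 => by omega
  · by_contra hsp
    have := h2 hsp
    omega
  · obtain ⟨c, w, hc, hq⟩ := WeylComplexity.exists_quadraticRelation_of_hasSpecialForm hpos hinj h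
    refine WeylComplexity.weylComplexity_eq (by norm_num)
      (WeylComplexity.weylProperty_three f hf hpos hinj h) fun s h1 h3 => ?_
    obtain rfl | rfl : s = 1 ∨ s = 2 := by omega
    · exact fun hW => WeylComplexity.not_linearIndependent_of_quadraticRelation hc hq
        (WeylComplexity.linearIndependent_of_weylProperty_one hW)
    · exact WeylComplexity.not_weylProperty_two_of_quadraticRelation hc hq
  · refine WeylComplexity.weylComplexity_eq one_le_two
      (WeylComplexity.weylProperty_two f hf hpos hinj hsp) fun s h1 h3 => ?_
    obtain rfl : s = 1 := by omega
    exact fun hW => hli (WeylComplexity.linearIndependent_of_weylProperty_one hW)
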